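/- Let $d\in\{2,3\}$, let $\Omega\subset\mathbb R^d$ be a bounded polygonal or polyhedral domain (open, connected, equal to the interior of its closure, with $\bar\Omega$ a finite union of $d$-simplices), $T>0$ and $k\ge 1$ an integer. Let $\{\mathcal T_h\}$ be a regular family of conforming simplicial triangulations of $\bar\Omega$: there is $\sigma>0$ such that every element $K$ of every $\mathcal T_h$ contains a ball of diameter $\operatorname{diam}(K)/\sigma$. Put $V_h=\{v\in C(\bar\Omega)\cap H^1_0(\Omega): v|_K\in P_k(K)\ \forall K\in\mathcal T_h\}$ and let $\Pi_h^{(1)}$ be Lagrange interpolation in the continuous $P_1$ finite element space. Write $(\cdot,\cdot)$ and $\|\cdot\|$ for the inner product and norm of $L^2(\Omega)$, $|w|_{1,\infty}=\bigl\|(\sum_{i,j}(\partial w_i/\partial x_j)^2)^{1/2}\bigr\|_{L^\infty(\Omega)}$ for $w\in W^{1,\infty}(\Omega)^d$, and $W^{1,\infty}_0(\Omega)$ for the functions in $W^{1,\infty}(\Omega)$ that vanish on $\partial\Omega$. Functions in $W^{1,\infty}(\Omega)$ are identified with their representatives continuous on $\bar\Omega$. Let $u\in C([0,T];W^{1,\infty}_0(\Omega)^d)$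 and $|u|_{C(W^{1,\infty})}=\max_{t\in[0,T]}|u(t)|_{1,\infty}$. (a) There is a constant $\alpha\ge 1$ such that $|\Pi_h^{(1)}w|_{1,\infty}\le\alpha|w|_{1,\infty}$ for all $\mathcal T_h$ in the family and all $w\in W^{1,\infty}(\Omega)^d$, and a constant $\delta\in(0,1)$ such that, for all $w\in W^{1,\infty}_0(\Omega)^d$ and $\Delta t>0$ with $\Delta t\,|w|_{1,\infty}\le\delta$, the map $x\mapsto x-w(x)\Delta t$ has Jacobian determinant in $[\frac12,\frac32]$ almost everywhere in $\Omega$. (b) Fix any such $\alpha$ and $\delta$. Then there is a constant $c>0$ such that the following holds for every $\mathcal T_h$ in the family, every $\Delta t$ with $0<\Delta t\le\delta/(\alpha|u|_{C(W^{1,\infty})})$ (no upper bound if $|u|_{C(W^{1,\infty})}=0$), every $\nu>0$, every $f\in C([0,T];L^2(\Omega))$ and every $\phi^0\in H_0^1(\Omega)$. Put $N_T=\lfloor T/\Delta t\rfloor$, $t^n=n\Delta t$, $f^n=f(t^n)$ and $X_{1h}^n(x)=x-(\Pi_h^{(1)}u(t^n))(x)\,\Delta t$. Let $\phi_h^0\in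 V_h$ be the Poisson projection of $\phi^0$, i.e. $(\nabla(\phi_h^0-\phi^0),\nabla\psi_h)=0$ for all $\psi_h\in V_h$, and let $\phi_h^1,\dots,\phi_h^{N_T}\in V_h$ solve the scheme $$\Bigl(\frac{\phi_h^n-\phi_h^{n-1}\circ X_{1h}^n}{\Delta t},\psi_h\Bigr)+\nu(\nabla\phi_h^n,\nabla\psi_h)=(f^n,\psi_h)\qquad\forall\psi_h\in V_h,\ n=1,\dots,N_T.$$ Then $$\max_{0\le n\le N_T}\|\phi_h^n\|+\sqrt\nu\Bigl(\Delta t\sum_{n=1}^{N_T}\|\nabla\phi_h^n\|^2\Bigr)^{1/2}\le c\Bigl(\|\phi_h^0\|+\Bigl(\Delta t\sum_{n=1}^{N_T}\|f^n\|^2\Bigr)^{1/2}\Bigr).$$ In particular $c$ is independent of $h$, $\Delta t$, $\nu$, $f$ and $\phi^0$. -/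

import Mathlib

open MeasureTheory Set Filter Topology
open scoped ENNReal ContDiff

noncomputable section

namespace GSLG

/-- Euclidean space `ℝ^d`. -/
abbrev Pt (d : ℕ) := EuclideanSpace ℝ (Fin d)

variable {d : ℕ}

/-! ### Weak derivatives and Sobolev spaces -/

/-- Test functions `C_c^∞(Ω)`. -/
def IsTest (Ω : Set (Pt d)) (ψ : Pt d → ℝ) : Prop :=
  ContDiff ℝ ∞ ψ ∧ HasCompactSupport ψ ∧ tsupport ψ ⊆ Ω

/-- `g` is a weak (distributional) gradient of `v` on `Ω`. -/
def IsWeakGrad (Ω : Set (Pt d)) (v : Pt d → ℝ) (g : Pt d → Pt d) : Prop :=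
  LocallyIntegrableOn v Ω ∧ LocallyIntegrableOn g Ω ∧
    ∀ ψ : Pt d → ℝ, IsTest Ω ψ → ∀ i : Fin d,
      ∫ x in Ω, v x * fderiv ℝ ψ x (EuclideanSpace.single i 1) = -∫ x in Ω, g x i * ψ x

def HasWeakGrad (Ω : Set (Pt d)) (v : Pt d → ℝ) : Prop := ∃ g, IsWeakGrad Ω v g

open Classical in
/-- The weak gradient `∇v` (unique a.e. on open `Ω`; only used where `HasWeakGrad Ω v`). -/
def weakGrad (Ω : Set (Pt d)) (v : Pt d → ℝ) : Pt d → Pt d :=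
  if h : HasWeakGrad Ω v then h.choose else 0

/-- `v ∈ H^1(Ω)`. -/
def MemH1 (Ω : Set (Pt d)) (v : Pt d → ℝ) : Prop :=
  MemLp v 2 (volume.restrict Ω) ∧ HasWeakGrad Ω v ∧ MemLp (weakGrad Ω v) 2 (volume.restrict Ω)

/-- `v ∈ H^1_0(Ω)`, the closure of `C_c^∞(Ω)` in `H^1(Ω)`. -/
def MemH10 (Ω : Set (Pt d)) (v : Pt d → ℝ) : Prop :=
  MemH1 Ω v ∧ ∃ ψ : ℕ → Pt d → ℝ, (∀ m, IsTest Ω (ψ m)) ∧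
    Tendsto (fun m => eLpNorm (fun x => v x - ψ m x) 2 (volume.restrict Ω)) atTop (𝓝 0) ∧
    Tendsto (fun m => eLpNorm (fun x => weakGrad Ω v x - gradient (ψ m) x) 2
      (volume.restrict Ω)) atTop (𝓝 0)

/-- The weak Jacobian matrix `(∂w_i/∂x_j)` of a vector field. -/
def weakJac (Ω : Set (Pt d)) (w : Pt d → Pt d) (x : Pt d) : Matrix (Fin d) (Fin d) ℝ :=
  Matrix.of fun i j => weakGrad Ω (fun y => w y i) x j

/-- The seminorm `|w|_{1,∞}`: essential supremum over `Ω` of the Frobenius norm of the weak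
Jacobian. -/
def semiW1inf (Ω : Set (Pt d)) (w : Pt d → Pt d) : ℝ≥0∞ :=
  eLpNorm (fun x => Real.sqrt (∑ i, ∑ j, (weakJac Ω w x i j) ^ 2)) ∞ (volume.restrict Ω)

/-- The norm `‖w‖_{1,∞}`. -/
def normW1inf (Ω : Set (Pt d)) (w : Pt d → Pt d) : ℝ≥0∞ :=
  max (eLpNorm w ∞ (volume.restrict Ω)) (semiW1inf Ω w)

/-- `w ∈ W^{1,∞}(Ω)^d`, given by its representative that is continuous on the closure of `Ω`
(the one that Lagrange interpolation evaluates). -/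
def MemW1inf (Ω : Set (Pt d)) (w : Pt d → Pt d) : Prop :=
  ContinuousOn w (closure Ω) ∧ MemLp w ∞ (volume.restrict Ω) ∧
    ∀ i, HasWeakGrad Ω (fun x => w x i) ∧
      MemLp (weakGrad Ω (fun x => w x i)) ∞ (volume.restrict Ω)

/-- `w ∈ W_0^{1,∞}(Ω)^d`: zero trace on the boundary. -/
def MemW01inf (Ω : Set (Pt d)) (w : Pt d → Pt d) : Prop :=
  MemW1inf Ω w ∧ ∀ x ∈ frontier Ω, w x = 0

/-- `u ∈ C([0,T]; W_0^{1,∞}(Ω)^d)`. -/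
def MemCW01inf (Ω : Set (Pt d)) (T : ℝ) (u : ℝ → Pt d → Pt d) : Prop :=
  (∀ t ∈ Icc 0 T, MemW01inf Ω (u t)) ∧
    ∀ t ∈ Icc 0 T, Tendsto (fun s => normW1inf Ω (fun x => u s x - u t x)) (𝓝[Icc 0 T] t) (𝓝 0)

/-- `|u|_{C(W^{1,∞})} = sup_{t ∈ [0,T]} |u(t)|_{1,∞}`. -/
def semiCW1inf (Ω : Set (Pt d)) (T : ℝ) (u : ℝ → Pt d → Pt d) : ℝ≥0∞ :=
  ⨆ t ∈ Icc 0 T, semiW1inf Ω (u t)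

/-! ### Domain, triangulations, finite elements -/

/-- A bounded polygonal (`d = 2`) or polyhedral (`d = 3`) domain: open, connected, equal to the
interior of its closure, and its closure is a finite union of `d`-simplices. -/
def IsPolyDomain (Ω : Set (Pt d)) : Prop :=
  IsOpen Ω ∧ IsConnected Ω ∧ interior (closure Ω) = Ω ∧
    ∃ S : Finset (Finset (Pt d)),
      (∀ K ∈ S, K.card = d + 1 ∧ AffineIndependent ℝ ((↑) : K → Pt d)) ∧
      closure Ω = ⋃ K ∈ S, convexHull ℝ (K : Set (Pt d))

/-- The elements of a triangulation (its `d`-simplices), given by their vertex sets. -/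
def elements (𝒯 : Geometry.SimplicialComplex ℝ (Pt d)) : Set (Finset (Pt d)) :=
  {K | K ∈ 𝒯.faces ∧ K.card = d + 1}

/-- `𝒯` is a (conforming, finite) triangulation of the closure of `Ω`. -/
def IsTriangulation (𝒯 : Geometry.SimplicialComplex ℝ (Pt d)) (Ω : Set (Pt d)) : Prop :=
  𝒯.faces.Finite ∧ (∀ s ∈ 𝒯.faces, ∃ K ∈ elements 𝒯, s ⊆ K) ∧ 𝒯.space = closure Ω

/-- A regular family of triangulations of the closure of `Ω`: there is `σ` such that each element
`K` of each triangulation contains a closed ball of diameter `diam K / σ`. -/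
def IsRegularFamily (𝔗 : Set (Geometry.SimplicialComplex ℝ (Pt d))) (Ω : Set (Pt d)) : Prop :=
  (∀ 𝒯 ∈ 𝔗, IsTriangulation 𝒯 Ω) ∧
    ∃ σ : ℝ, 0 < σ ∧ ∀ 𝒯 ∈ 𝔗, ∀ K ∈ elements 𝒯, ∃ x : Pt d, ∃ r : ℝ,
      Metric.diam (convexHull ℝ (K : Set (Pt d))) ≤ σ * (2 * r) ∧
      Metric.closedBall x r ⊆ convexHull ℝ (K : Set (Pt d))

/-- `c` are barycentric coordinates of the point `x` of the simplex with vertex set `K`. -/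
def IsBary (K : Finset (Pt d)) (x : Pt d) (c : Pt d → ℝ) : Prop :=
  (∀ v ∈ K, 0 ≤ c v) ∧ ∑ v ∈ K, c v = 1 ∧ ∑ v ∈ K, c v • v = x

open Classical in
/-- The `P_1` Lagrange interpolant `Π_h^{(1)} w`: at a point of an element `K` with barycentric
coordinates `c_v` its value is `∑_v c_v w(v)` (extended by `0` off the triangulated set). -/
def lagrangeP1 (𝒯 : Geometry.SimplicialComplex ℝ (Pt d)) (w : Pt d → Pt d) (x : Pt d) : Pt d :=
  if h : ∃ p : Finset (Pt d) × (Pt d → ℝ), p.1 ∈ elements 𝒯 ∧ IsBary p.1 x p.2 then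
    ∑ v ∈ h.choose.1, h.choose.2 v • w v
  else 0

/-- Barycentric coordinates in two elements agree after extension by zero. -/
theorem bary_sum_eq (𝒯 : Geometry.SimplicialComplex ℝ (Pt d)) (w : Pt d → Pt d)
    {K L : Finset (Pt d)} (hK : K ∈ 𝒯.faces) (hL : L ∈ 𝒯.faces) {x : Pt d} {a b : Pt d → ℝ}
    (ha : IsBary K x a) (hb : IsBary L x b) :
    ∑ v ∈ K, a v • w v = ∑ v ∈ L, b v • w v := by
  classical
  have hull : ∀ {M : Finset (Pt d)} {c : Pt d → ℝ}, IsBary M x c →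
      x ∈ convexHull ℝ (M : Set (Pt d)) := by
    intro M c hc
    rw [Finset.mem_convexHull']
    exact ⟨c, hc.1, hc.2.1, hc.2.2⟩
  have hx : x ∈ convexHull ℝ ((K ∩ L : Finset (Pt d)) : Set (Pt d)) := by
    rw [Finset.coe_inter]
    exact 𝒯.inter_subset_convexHull hK hL ⟨hull ha, hull hb⟩
  rw [Finset.mem_convexHull'] at hx
  obtain ⟨c, -, hc1, hc2⟩ := hx
  have key : ∀ {M : Finset (Pt d)} {m : Pt d → ℝ}, M ∈ 𝒯.faces → K ∩ L ⊆ M → IsBary M x m →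
      ∑ v ∈ M, m v • w v = ∑ v ∈ K ∩ L, c v • w v := by
    intro M m hM hsub hm
    have e : ∀ v ∈ M, m v = if v ∈ K ∩ L then c v else 0 := by
      have hi := affineIndependent_iff.1 (𝒯.indep hM) Finset.univ
        (fun v => m v - if (v : Pt d) ∈ K ∩ L then c v else 0) ?_ ?_
      · intro v hv
        have := hi ⟨v, hv⟩ (Finset.mem_univ _)
        exact sub_eq_zero.1 this
      · have := Finset.sum_coe_sort M (fun v => m v - if v ∈ K ∩ L then c v else 0)
        rw [this, Finset.sum_sub_distrib, hm.2.1, Finset.sum_ite_mem,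
          Finset.inter_eq_right.2 hsub, hc1, sub_self]
      · have := Finset.sum_coe_sort M (fun v => (m v - if v ∈ K ∩ L then c v else 0) • v)
        rw [this]
        simp only [sub_smul, ite_smul, zero_smul]
        rw [Finset.sum_sub_distrib, hm.2.2, Finset.sum_ite_mem,
          Finset.inter_eq_right.2 hsub, hc2, sub_self]
    rw [Finset.sum_congr rfl (fun v hv => by rw [e v hv])]
    simp only [ite_smul, zero_smul]
    rw [Finset.sum_ite_mem, Finset.inter_eq_right.2 hsub]
  rw [key hK Finset.inter_subset_left ha, key hL Finset.inter_subset_right hb]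

/-- The interpolant does not depend on the element used to evaluate it. -/
theorem lagrangeP1_eq (𝒯 : Geometry.SimplicialComplex ℝ (Pt d)) (w : Pt d → Pt d)
    {K : Finset (Pt d)} (hK : K ∈ elements 𝒯) {x : Pt d} {c : Pt d → ℝ} (hc : IsBary K x c) :
    lagrangeP1 𝒯 w x = ∑ v ∈ K, c v • w v := by
  have h : ∃ p : Finset (Pt d) × (Pt d → ℝ), p.1 ∈ elements 𝒯 ∧ IsBary p.1 x p.2 :=
    ⟨(K, c), hK, hc⟩
  rw [lagrangeP1, dif_pos h]
  exact bary_sum_eq 𝒯 w h.choose_spec.1.1 hK.1 h.choose_spec.2 hc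

/-- `v ∈ V_h`, the `P_k` finite element space with zero boundary values:
`V_h = {v ∈ C(closure Ω) ∩ H^1_0(Ω) ; v|_K ∈ P_k(K) for all elements K}`. -/
def MemVh (Ω : Set (Pt d)) (𝒯 : Geometry.SimplicialComplex ℝ (Pt d)) (k : ℕ)
    (v : Pt d → ℝ) : Prop :=
  ContinuousOn v (closure Ω) ∧ MemH10 Ω v ∧
    ∀ K ∈ elements 𝒯, ∃ p : MvPolynomial (Fin d) ℝ, p.totalDegree ≤ k ∧
      ∀ x ∈ convexHull ℝ (K : Set (Pt d)), v x = MvPolynomial.eval (fun i => x i) p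

/-- `p ∈ V_h` is the Poisson projection of `φ`. -/
def IsPoissonProj (Ω : Set (Pt d)) (𝒯 : Geometry.SimplicialComplex ℝ (Pt d)) (k : ℕ)
    (φ p : Pt d → ℝ) : Prop :=
  MemVh Ω 𝒯 k p ∧ ∀ ψ, MemVh Ω 𝒯 k ψ →
    ∫ x in Ω, inner ℝ (weakGrad Ω (fun y => p y - φ y) x) (weakGrad Ω ψ x) = 0

/-! ### The scheme -/

/-- The map `X_1(w)(x) = x - w(x) Δt`. -/
def X1 (Δt : ℝ) (w : Pt d → Pt d) (x : Pt d) : Pt d := x - Δt • w x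

/-- The number of time steps `N_T = ⌊T / Δt⌋`. -/
def numSteps (T Δt : ℝ) : ℕ := ⌊T / Δt⌋₊

/-- `(φ_h^n)_n`, `0 ≤ n ≤ N_T`, is a solution of the scheme GSLG with velocity `u`, source
`f ∈ C([0,T]; L²(Ω))` and initial datum `φ0`. -/
structure IsGSLGSolution (Ω : Set (Pt d)) (T : ℝ) (k : ℕ) (u : ℝ → Pt d → Pt d)
    (𝒯 : Geometry.SimplicialComplex ℝ (Pt d)) (Δt ν : ℝ)
    (f : ℝ → Lp ℝ 2 (volume.restrict Ω)) (φ0 : Pt d → ℝ) (φ : ℕ → Pt d → ℝ) : Prop where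
  init : IsPoissonProj Ω 𝒯 k φ0 (φ 0)
  mem : ∀ n, 1 ≤ n → n ≤ numSteps T Δt → MemVh Ω 𝒯 k (φ n)
  step : ∀ n, 1 ≤ n → n ≤ numSteps T Δt → ∀ ψ, MemVh Ω 𝒯 k ψ →
    (∫ x in Ω, (φ n x - φ (n - 1) (X1 Δt (lagrangeP1 𝒯 (u (n * Δt))) x)) / Δt * ψ x)
      + ν * ∫ x in Ω, inner ℝ (weakGrad Ω (φ n) x) (weakGrad Ω ψ x)
    = ∫ x in Ω, f (n * Δt) x * ψ x

/-- The `L²(Ω)` norm. -/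
def l2norm {F : Type*} [NormedAddCommGroup F] (Ω : Set (Pt d)) (v : Pt d → F) : ℝ :=
  (eLpNorm v 2 (volume.restrict Ω)).toReal

/-- The norm `ℓ^∞(L²)` of `a^0, …, a^N`, from the values `a^n` of the `L²` norms. -/
def ellInf (N : ℕ) (a : ℕ → ℝ) : ℝ :=
  (Finset.range (N + 1)).sup' Finset.nonempty_range_add_one a

/-- The norm `ℓ²(1,N;L²)`, from the values `a^n` of the `L²` norms. -/
def ellTwo (Δt : ℝ) (N : ℕ) (a : ℕ → ℝ) : ℝ :=
  Real.sqrt (Δt * ∑ n ∈ Finset.Icc 1 N, a n ^ 2)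

/-! ### The two constants in the time-step restriction -/

/-- `α ≥ 1` is a stability constant of `P_1` interpolation in `W^{1,∞}` for the family. -/
def IsInterpConst (Ω : Set (Pt d)) (𝔗 : Set (Geometry.SimplicialComplex ℝ (Pt d)))
    (α : ℝ) : Prop :=
  1 ≤ α ∧ ∀ 𝒯 ∈ 𝔗, ∀ w, MemW1inf Ω w →
    semiW1inf Ω (lagrangeP1 𝒯 w) ≤ ENNReal.ofReal α * semiW1inf Ω w

/-- `δ ∈ (0,1)` is such that `Δt |w|_{1,∞} ≤ δ` forces `1/2 ≤ det(∂X_1(w)/∂x) ≤ 3/2`. -/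
def IsJacobianConst (Ω : Set (Pt d)) (δ : ℝ) : Prop :=
  0 < δ ∧ δ < 1 ∧ ∀ w, MemW01inf Ω w → ∀ Δt : ℝ, 0 < Δt →
    ENNReal.ofReal Δt * semiW1inf Ω w ≤ ENNReal.ofReal δ →
    ∀ᵐ x ∂(volume.restrict Ω),
      (1 - Δt • weakJac Ω w x).det ∈ Icc (1 / 2 : ℝ) (3 / 2)

end GSLG

end

noncomputable section

namespace GSLG

variable {d : ℕ}

/-! Testing the scheme with `φ (n + 1)` itself gives ‖φⁿ⁺¹‖² + νΔt‖∇φⁿ⁺¹‖² = (φⁿ∘X, φⁿ⁺¹) + Δt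
(fⁿ⁺¹, φⁿ⁺¹). Everything hinges on ‖φⁿ∘X‖ ≤ e^{BΔt}‖φⁿ‖ with B independent of h, Δt and ν; a
discrete Gronwall argument (`discrete_stability`) then yields both parts of the estimate.

The composition bound comes from a metric argument, not from a change of variables. With w = Π_h u
and L = α|u|, the field w is L-Lipschitz on all of ℝ^d (`lipschitzWith_lagrangeP1`), so for ΔtL ≤ δ
< 1 the map X = id - Δt w is antilipschitz with constant (1 - ΔtL)⁻¹. Comparison with Hausdorff
measure shows that preimages under X gain volume by at most the d-th power of this constant. Since w
vanishes off Ω, X fixes the complement of Ω, and injectivity keeps Ω inside Ω.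

The global Lipschitz bound has two ingredients. On each element w is affine and its gradient is the
weak gradient, so |w|_{1,∞} bounds it; such bounds glue across a finite closed cover of ℝ^d. And w
is zero off Ω, including on ∂Ω, because every vertex with positive weight at a boundary point is
itself a boundary point (`mem_interior_of_vertex`).

For part (a), α comes from the Lipschitz bound for W^{1,∞} functions on convex elements together
with the inscribed ball of each element, and δ from continuity of the determinant at the identity.
-/

/-! ### Lipschitz maps -/

/-- A map that is `K`-Lipschitz on each set of a finite closed cover of a normed space is
`K`-Lipschitz. -/
theorem lipschitzWith_of_finite_closed_cover {ι E F : Type*} [Finite ι] [NormedAddCommGroup E]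
    [NormedSpace ℝ E] [NormedAddCommGroup F] {C : ι → Set E} (hC : ∀ i, IsClosed (C i))
    (hcov : ⋃ i, C i = univ) {f : E → F} {K : NNReal} (hf : ∀ i, LipschitzOnWith K f (C i)) :
    LipschitzWith K f := by
  have hcont : Continuous f :=
    (locallyFinite_of_finite C).continuous hcov hC fun i => (hf i).continuousOn
  apply LipschitzWith.of_dist_le_mul
  intro x y
  set ℓ : ℝ → E := fun t => y + t • (x - y) with hℓ
  have hℓc : Continuous ℓ := by fun_prop
  have key := image_le_of_liminf_slope_right_le_deriv_boundary (a := 0) (b := 1)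
    (f := fun t => ‖f (ℓ t) - f y‖) (B := fun t => t * (K * ‖x - y‖))
    (B' := fun _ => K * ‖x - y‖) (by fun_prop) (by simp [hℓ]) (by fun_prop)
    (fun t _ => by simpa using ((hasDerivAt_id t).mul_const _).hasDerivWithinAt) ?_
    (right_mem_Icc.2 zero_le_one)
  · simpa [hℓ, dist_eq_norm] using key
  intro t _ r hr
  -- By finiteness, some `C i` is visited for times arbitrarily close to `t` from the right; being
  -- closed, it also contains `ℓ t`. Its Lipschitz bound then controls the lower right slope at `t`,
  -- which is all that the comparison principle needs.
  have hex : ∃ i, ∃ᶠ z in 𝓝[>] t, ℓ z ∈ C i := by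
    by_contra! h
    have h' : ∀ᶠ z in 𝓝[>] t, ∀ i, ℓ z ∉ C i := eventually_all.2 fun i => by
      simpa using h i
    obtain ⟨z, hz⟩ := h'.exists
    have : ℓ z ∈ ⋃ i, C i := hcov ▸ mem_univ _
    obtain ⟨i, hi⟩ := mem_iUnion.1 this
    exact hz i hi
  obtain ⟨i, hi⟩ := hex
  have hti : ℓ t ∈ C i :=
    (hC i).mem_of_frequently_of_tendsto hi (hℓc.continuousAt.tendsto.mono_left nhdsWithin_le_nhds)
  refine (hi.and_eventually self_mem_nhdsWithin).mono ?_
  rintro z ⟨hz, hzt⟩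
  have hzt : t < z := hzt
  refine lt_of_le_of_lt ?_ hr
  rw [slope_def_field, div_le_iff₀ (sub_pos.2 hzt)]
  calc ‖f (ℓ z) - f y‖ - ‖f (ℓ t) - f y‖ ≤ ‖f (ℓ z) - f (ℓ t)‖ := by
        have := norm_sub_norm_le (f (ℓ z) - f y) (f (ℓ t) - f y)
        simpa using this
    _ ≤ K * ‖ℓ z - ℓ t‖ := by
        simpa [dist_eq_norm] using (hf i).dist_le_mul _ hz _ hti
    _ = K * ‖x - y‖ * (z - t) := by
        have : ℓ z - ℓ t = (z - t) • (x - y) := by simp only [hℓ]; module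
        rw [this, norm_smul, Real.norm_of_nonneg (sub_pos.2 hzt).le]; ring

/-- Lebesgue measure is a constant multiple of d-dimensional Hausdorff measure, which scales by at
most `K ^ d` under preimages by antilipschitz maps; the constant cancels. No differentiability of
`X` enters. -/
theorem volume_preimage_le {K : NNReal} {X : Pt d → Pt d} (hX : AntilipschitzWith K X)
    (s : Set (Pt d)) : volume (X ⁻¹' s) ≤ (K : ℝ≥0∞) ^ d * volume s := by
  have h := Measure.isAddLeftInvariant_eq_smul (volume : Measure (Pt d)) (Measure.hausdorffMeasure d)
  rw [h]
  simp only [Measure.smul_apply, ENNReal.smul_def, smul_eq_mul]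
  have := hX.hausdorffMeasure_preimage_le (d := (d : ℝ)) d.cast_nonneg s
  rw [ENNReal.rpow_natCast] at this
  calc _ ≤ _ := mul_le_mul_right this _
    _ = _ := by ring

/-- Composition with an antilipschitz map of `Ω` into itself is bounded on integrals. -/
theorem lintegral_comp_le {Ω : Set (Pt d)} {K : NNReal} {X : Pt d → Pt d}
    (hX : AntilipschitzWith K X) (hXc : Continuous X) (hmaps : ∀ x ∈ Ω, X x ∈ Ω)
    {g : Pt d → ℝ≥0∞} (hg : AEMeasurable g (volume.restrict Ω)) :
    ∫⁻ x in Ω, g (X x) ≤ (K : ℝ≥0∞) ^ d * ∫⁻ x in Ω, g x := by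
  have hmap : (volume.restrict Ω).map X ≤ ((K : ℝ≥0∞) ^ d) • volume.restrict Ω := by
    refine Measure.le_iff.2 fun s hs => ?_
    rw [Measure.map_apply hXc.measurable hs, Measure.restrict_apply (hXc.measurable hs),
      Measure.smul_apply, Measure.restrict_apply hs, smul_eq_mul]
    refine (measure_mono ?_).trans (volume_preimage_le hX _)
    exact fun x hx => ⟨hx.1, hmaps x hx.2⟩
  -- Absolute continuity carries the a.e. measurability of `g` over to the pushforward measure.
  have hac : (volume.restrict Ω).map X ≪ volume.restrict Ω :=
    (Measure.absolutelyContinuous_of_le hmap).trans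
      Measure.smul_absolutelyContinuous
  calc ∫⁻ x in Ω, g (X x) = ∫⁻ y, g y ∂((volume.restrict Ω).map X) :=
        (lintegral_map' (hg.mono_ac hac) hXc.aemeasurable).symm
    _ ≤ ∫⁻ y, g y ∂(((K : ℝ≥0∞) ^ d) • volume.restrict Ω) := lintegral_mono' hmap le_rfl
    _ = _ := lintegral_smul_measure _ _

/-! ### Weak gradients -/

theorem inner_eq_sum (y z : Pt d) : inner ℝ y z = ∑ i, y i * z i := by
  simp [PiLp.inner_apply, mul_comm]

theorem integrable_mul_of_locallyIntegrableOn {Ω : Set (Pt d)} {f ψ : Pt d → ℝ}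
    (hf : LocallyIntegrableOn f Ω) (hψ : Continuous ψ) (hc : HasCompactSupport ψ)
    (hs : tsupport ψ ⊆ Ω) : Integrable fun x => f x * ψ x := by
  have h1 : IntegrableOn f (tsupport ψ) := hf.integrableOn_compact_subset hs hc
  have h2 : IntegrableOn (fun x => f x * ψ x) (tsupport ψ) :=
    h1.mul_continuousOn hψ.continuousOn hc
  refine (integrableOn_iff_integrable_of_support_subset ?_).1 h2
  exact (Function.support_mul_subset_right _ _).trans (subset_tsupport ψ)

theorem locallyIntegrableOn_coord {Ω : Set (Pt d)} {g : Pt d → Pt d}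
    (hg : LocallyIntegrableOn g Ω) (i : Fin d) : LocallyIntegrableOn (fun x => g x i) Ω := by
  intro x hx
  obtain ⟨s, hs, h⟩ := hg x hx
  exact ⟨s, hs, (EuclideanSpace.proj (𝕜 := ℝ) i).integrable_comp h⟩

theorem isWeakGrad_weakGrad {Ω : Set (Pt d)} {v : Pt d → ℝ} (h : HasWeakGrad Ω v) :
    IsWeakGrad Ω v (weakGrad Ω v) := by
  rw [weakGrad, dif_pos h]; exact h.choose_spec

theorem weakGrad_of_not {Ω : Set (Pt d)} {v : Pt d → ℝ} (h : ¬ HasWeakGrad Ω v) :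
    weakGrad Ω v = 0 := by
  rw [weakGrad, dif_neg h]

theorem IsTest.tsupport_fderiv_subset {Ω : Set (Pt d)} {ψ : Pt d → ℝ} (hψ : IsTest Ω ψ)
    (y : Pt d) : tsupport (fun x => fderiv ℝ ψ x y) ⊆ Ω :=
  (_root_.tsupport_fderiv_apply_subset ℝ y).trans hψ.2.2

/-- The weak gradient of a function that is affine on an open subset. -/
theorem weakGrad_eq_of_affineOn {Ω U : Set (Pt d)} (hU : IsOpen U) (hUΩ : U ⊆ Ω)
    {v : Pt d → ℝ} (h : HasWeakGrad Ω v) (g : Pt d) (c : ℝ)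
    (hv : ∀ x ∈ U, v x = inner ℝ g x + c) :
    ∀ᵐ x, x ∈ U → weakGrad Ω v x = g := by
  have hw := isWeakGrad_weakGrad h
  have hcoord : ∀ i, ∀ᵐ x, x ∈ U → weakGrad Ω v x i - g i = 0 := by
    intro i
    have hloc : LocallyIntegrableOn (fun x => weakGrad Ω v x i - g i) U :=
      ((locallyIntegrableOn_coord hw.2.1 i).mono_set hUΩ).sub
        ((locallyIntegrable_const _).locallyIntegrableOn U)
    -- Fundamental lemma of the calculus of variations: for ψ supported in `U`, `v` may be replaced
    -- by the affine function, and classical integration by parts shows that the i-th components of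
    -- `weakGrad Ω v` and `g` have the same integral against ψ.
    refine hU.ae_eq_zero_of_integral_contDiff_smul_eq_zero hloc fun ψ hψ hc hs => ?_
    have hT : IsTest Ω ψ := ⟨hψ, hc, hs.trans hUΩ⟩
    set e : Pt d := EuclideanSpace.single i 1
    have hψd : Continuous fun x => fderiv ℝ ψ x e :=
      (hψ.continuous_fderiv (by simp)).clm_apply continuous_const
    have hψc : HasCompactSupport fun x => fderiv ℝ ψ x e := hc.fderiv_apply ℝ e
    have hweak := hw.2.2 ψ hT i
    have hrestr : ∀ q : Pt d → ℝ, Function.support q ⊆ U → ∫ x in Ω, q x = ∫ x, q x :=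
      fun q hq => setIntegral_eq_integral_of_forall_compl_eq_zero fun x hx => by
        by_contra h0; exact hx (hUΩ (hq h0))
    have hsψ : Function.support ψ ⊆ U := (subset_tsupport ψ).trans hs
    have hsd : Function.support (fun x => fderiv ℝ ψ x e) ⊆ U :=
      (subset_tsupport _).trans ((_root_.tsupport_fderiv_apply_subset ℝ e).trans hs)
    rw [hrestr _ ((Function.support_mul_subset_right _ _).trans hsd),
      hrestr _ ((Function.support_mul_subset_right _ _).trans hsψ)] at hweak
    have hfd : ∀ x, fderiv ℝ (fun x : Pt d => inner ℝ g x + c) x e = g i := by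
      intro x
      have : HasFDerivAt (fun x : Pt d => inner ℝ g x + c) (innerSL ℝ g) x :=
        ((innerSL ℝ g).hasFDerivAt).add_const c
      rw [this.fderiv]
      simp [e, inner_eq_sum]
    have haff : Continuous fun x : Pt d => inner ℝ g x + c := by fun_prop
    have hparts := integral_mul_fderiv_eq_neg_fderiv_mul_of_integrable (μ := volume)
      (f := fun x : Pt d => inner ℝ g x + c) (g := ψ) (v := e)
      (by simp only [hfd]; exact (hψ.continuous.integrable_of_hasCompactSupport hc).const_mul _)
      ((haff.mul hψd).integrable_of_hasCompactSupport hψc.mul_left)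
      ((haff.mul hψ.continuous).integrable_of_hasCompactSupport hc.mul_left)
      (fun x _ => ((innerSL ℝ g).differentiableAt).add_const c) (fun x _ => (hψ.differentiable (by simp)).differentiableAt)
    have heq : ∫ x, v x * fderiv ℝ ψ x e = ∫ x, (inner ℝ g x + c) * fderiv ℝ ψ x e := by
      refine integral_congr_ae (Eventually.of_forall fun x => ?_)
      by_cases hx : x ∈ U
      · simp only [hv x hx]
      · have : fderiv ℝ ψ x e = 0 := by
          by_contra h0; exact hx (hsd h0)
        simp only [this, mul_zero]
    rw [heq, hparts] at hweak
    simp only [hfd] at hweak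
    have hI := integrable_mul_of_locallyIntegrableOn (locallyIntegrableOn_coord hw.2.1 i)
      hψ.continuous hc (hs.trans hUΩ)
    have : ∀ x, ψ x • (weakGrad Ω v x i - g i) = weakGrad Ω v x i * ψ x - g i * ψ x := by
      intro x; simp only [smul_eq_mul]; ring
    simp only [this]
    rw [integral_sub hI ((hψ.continuous.integrable_of_hasCompactSupport hc).const_mul _)]
    linarith
  filter_upwards [ae_all_iff.2 hcoord] with x hx hxU
  ext i
  exact sub_eq_zero.1 (hx i hxU)

/-- A Lipschitz function has a weak gradient. -/
theorem hasWeakGrad_of_lipschitz {Ω : Set (Pt d)} {v : Pt d → ℝ} {K : NNReal}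
    (hv : LipschitzWith K v) : HasWeakGrad Ω v := by
  -- The witness consists of the line derivatives along the axes: bounded by the Lipschitz constant,
  -- and subject to integration by parts.
  refine ⟨fun x => WithLp.toLp 2 fun i => lineDeriv ℝ v x (EuclideanSpace.single i 1),
    hv.continuous.locallyIntegrable.locallyIntegrableOn Ω, ?_, ?_⟩
  · refine LocallyIntegrable.locallyIntegrableOn ?_ Ω
    refine MemLp.locallyIntegrable (p := ∞) (MemLp.of_eval_piLp fun i => ?_) le_top
    exact hv.memLp_lineDeriv _
  · intro ψ hψ i
    set e : Pt d := EuclideanSpace.single i 1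
    obtain ⟨D, hD⟩ := hψ.1.lipschitzWith_of_hasCompactSupport hψ.2.1 (by simp)
    have hp := hv.integral_lineDeriv_mul_eq (μ := volume) hD hψ.2.1 e
    have hline : ∀ x, lineDeriv ℝ ψ x (-e) = -fderiv ℝ ψ x e := fun x => by
      rw [((hψ.1.differentiable (by simp)).differentiableAt).lineDeriv_eq_fderiv, map_neg]
    have hrestr : ∀ q : Pt d → ℝ, Function.support q ⊆ Ω → ∫ x in Ω, q x = ∫ x, q x :=
      fun q hq => setIntegral_eq_integral_of_forall_compl_eq_zero fun x hx => by
        by_contra h0; exact hx (hq h0)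
    rw [hrestr _ ((Function.support_mul_subset_right _ _).trans
        ((subset_tsupport _).trans (hψ.tsupport_fderiv_subset e))),
      hrestr _ ((Function.support_mul_subset_right _ _).trans
        ((subset_tsupport _).trans hψ.2.2))]
    change _ = -∫ x, lineDeriv ℝ v x e * ψ x
    rw [hp, ← integral_neg]
    simp only [hline]
    congr 1; ext x; ring

theorem IsWeakGrad.integral_mul_fderiv {Ω : Set (Pt d)} {v : Pt d → ℝ} {g : Pt d → Pt d}
    (h : IsWeakGrad Ω v g) {ψ : Pt d → ℝ} (hψ : IsTest Ω ψ) (y : Pt d) :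
    ∫ x in Ω, v x * fderiv ℝ ψ x y = -∫ x in Ω, inner ℝ y (g x) * ψ x := by
  have hy : y = ∑ i, y i • (EuclideanSpace.single i 1 : Pt d) := by
    simpa using ((EuclideanSpace.basisFun (Fin d) ℝ).sum_repr y).symm
  have h1 : ∀ x, v x * fderiv ℝ ψ x y
      = ∑ i, y i * (v x * fderiv ℝ ψ x (EuclideanSpace.single i 1)) := by
    intro x
    conv_lhs => rw [hy]
    rw [map_sum, Finset.mul_sum]
    refine Finset.sum_congr rfl fun i _ => ?_
    rw [map_smul, smul_eq_mul]; ring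
  have h2 : ∀ x, inner ℝ y (g x) * ψ x = ∑ i, y i * (g x i * ψ x) := by
    intro x
    rw [inner_eq_sum, Finset.sum_mul]
    exact Finset.sum_congr rfl fun i _ => by ring
  simp only [h1, h2]
  rw [integral_finsetSum, integral_finsetSum, ← Finset.sum_neg_distrib]
  · refine Finset.sum_congr rfl fun i _ => ?_
    rw [integral_const_mul, integral_const_mul, h.2.2 ψ hψ i]; ring
  · exact fun i _ => ((integrable_mul_of_locallyIntegrableOn
      (locallyIntegrableOn_coord h.2.1 i) hψ.1.continuous hψ.2.1 hψ.2.2).integrableOn).const_mul _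
  · exact fun i _ => ((integrable_mul_of_locallyIntegrableOn h.1
      ((hψ.1.continuous_fderiv (by simp)).clm_apply continuous_const)
      (hψ.2.1.fderiv_apply ℝ _) (hψ.tsupport_fderiv_subset _)).integrableOn).const_mul _

/-- A continuous function with weak gradient bounded by `L` on an open set is `L`-Lipschitz along
segments contained in that set. -/
theorem IsWeakGrad.abs_sub_le_of_segment_subset {Ω : Set (Pt d)} (hΩ : IsOpen Ω) {v : Pt d → ℝ}
    {g : Pt d → Pt d} (h : IsWeakGrad Ω v g) (hvc : ContinuousOn v Ω) (hvi : IntegrableOn v Ω)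
    {L : ℝ} (hg : ∀ᵐ x ∂volume.restrict Ω, ‖g x‖ ≤ L) {x y : Pt d} (hseg : segment ℝ x y ⊆ Ω) :
    |v x - v y| ≤ L * ‖x - y‖ := by
  apply le_of_forall_pos_le_add
  intro ε hε
  have hloc : ∀ z ∈ Ω, ∃ r > 0, ∀ t ∈ Metric.ball z r, dist (v t) (v z) ≤ ε / 2 := by
    intro z hz
    have := Metric.continuousAt_iff.1 (hvc.continuousAt (hΩ.mem_nhds hz)) (ε / 2) (half_pos hε)
    obtain ⟨r, hr, h⟩ := this
    exact ⟨r, hr, fun t ht => (h ht).le⟩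
  obtain ⟨r₁, hr₁, h₁⟩ := hloc x (hseg (left_mem_segment ℝ x y))
  obtain ⟨r₂, hr₂, h₂⟩ := hloc y (hseg (right_mem_segment ℝ x y))
  have hcpt : IsCompact (segment ℝ x y) := by
    rw [segment_eq_image_lineMap]
    exact isCompact_Icc.image AffineMap.lineMap_continuous
  obtain ⟨r₀, hr₀, h₀⟩ := hcpt.exists_cthickening_subset_open hΩ hseg
  -- At this scale the mollified function is defined by values inside `Ω` all along the segment and
  -- is within ε/2 of `v` at both endpoints.
  set r := min r₀ (min r₁ r₂) with hr
  have hrpos : 0 < r := lt_min hr₀ (lt_min hr₁ hr₂)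
  have hball : ∀ z ∈ segment ℝ x y, Metric.closedBall z r ⊆ Ω := fun z hz =>
    (Metric.closedBall_subset_cthickening hz r).trans
      ((Metric.cthickening_mono (min_le_left _ _) _).trans h₀)
  let φ : ContDiffBump (0 : Pt d) := ⟨r / 2, r, half_pos hrpos, half_lt_self hrpos⟩
  set ρ := φ.normed volume with hρ
  set w : Pt d → ℝ := Ω.indicator v with hw
  have hwi : Integrable w := (integrable_indicator_iff hΩ.measurableSet).2 hvi
  -- The flip places the smooth kernel on the right, the factor that is differentiated.
  set B : ℝ →L[ℝ] ℝ →L[ℝ] ℝ := (ContinuousLinearMap.lsmul ℝ ℝ).flip with hB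
  set H : Pt d → ℝ := convolution w ρ B volume with hH
  have hHdist : ∀ z ∈ segment ℝ x y, (∀ t ∈ Metric.ball z r, dist (v t) (v z) ≤ ε / 2) →
      dist (H z) (v z) ≤ ε / 2 := by
    intro z hz hzt
    have hwz : ∀ t ∈ Metric.closedBall z r, w t = v t := fun t ht =>
      indicator_of_mem (hball z hz ht) v
    have := φ.dist_normed_convolution_le (μ := volume) (g := w) (x₀ := z) (ε := ε / 2)
      hwi.aestronglyMeasurable (fun t ht => by
        rw [hwz t (Metric.ball_subset_closedBall ht),
          hwz z (Metric.mem_closedBall_self hrpos.le)]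
        exact hzt t ht)
    rw [hwz z (Metric.mem_closedBall_self hrpos.le)] at this
    rw [hH, hB, convolution_flip]
    exact this
  have hρc : HasCompactSupport ρ := φ.hasCompactSupport_normed
  have hρs : ContDiff ℝ ∞ ρ := φ.contDiff_normed
  have hder : ∀ z, HasFDerivAt H (convolution w (fderiv ℝ ρ) (B.precompR (Pt d)) volume z) z :=
    fun z => hρc.hasFDerivAt_convolution_right B hwi.locallyIntegrable (hρs.of_le (by simp)) z
  have hbound : ∀ z ∈ segment ℝ x y,
      ‖convolution w (fderiv ℝ ρ) (B.precompR (Pt d)) volume z‖ ≤ L := by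
    intro z hz
    -- The reflected kernel is a test function on `Ω` of integral 1, so the derivative of the
    -- mollification at `z` is an average of `g` and inherits the bound `L`.
    set ψ : Pt d → ℝ := fun t => ρ (z - t) with hψ
    have hψsupp : Function.support ψ ⊆ Metric.ball z r := by
      intro t ht
      have : z - t ∈ Function.support ρ := ht
      rw [hρ, φ.support_normed_eq] at this
      simpa [dist_eq_norm, norm_sub_rev] using this
    have hψt : tsupport ψ ⊆ Metric.closedBall z r :=
      closure_minimal (hψsupp.trans Metric.ball_subset_closedBall) Metric.isClosed_closedBall
    have hψsm : ContDiff ℝ ∞ ψ := hρs.comp (contDiff_const.sub contDiff_id)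
    have hψcpt : HasCompactSupport ψ :=
      HasCompactSupport.of_support_subset_isCompact (isCompact_closedBall z r)
        (hψsupp.trans Metric.ball_subset_closedBall)
    have hT : IsTest Ω ψ := ⟨hψsm, hψcpt, hψt.trans (hball z hz)⟩
    have hψint : ∫ t, ψ t = 1 := by
      rw [hψ, integral_sub_left_eq_self ρ volume z]
      exact φ.integral_normed
    have hψnn : ∀ t, 0 ≤ ψ t := fun t => φ.nonneg_normed _
    have hψΩ : ∫ t in Ω, ψ t = 1 := by
      rw [← hψint]
      refine setIntegral_eq_integral_of_forall_compl_eq_zero fun t ht => ?_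
      by_contra h0
      exact ht (hball z hz (Metric.ball_subset_closedBall (hψsupp h0)))
    have happ : ∀ u, convolution w (fderiv ℝ ρ) (B.precompR (Pt d)) volume z u
        = ∫ t in Ω, inner ℝ u (g t) * ψ t := by
      intro u
      have hex : ConvolutionExistsAt w (fderiv ℝ ρ) z (B.precompR (Pt d)) volume :=
        (hρc.fderiv ℝ).convolutionExists_right (B.precompR (Pt d)) hwi.locallyIntegrable
          (hρs.continuous_fderiv (by simp)) z
      rw [convolution, ContinuousLinearMap.integral_apply hex]
      have hfd : ∀ t, fderiv ℝ ψ t u = -fderiv ℝ ρ (z - t) u := by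
        intro t
        have : HasFDerivAt ψ ((fderiv ℝ ρ (z - t)).comp (-ContinuousLinearMap.id ℝ (Pt d))) t :=
          ((hρs.differentiable (by simp)).differentiableAt.hasFDerivAt).comp t
            ((hasFDerivAt_id t).const_sub z)
        rw [this.fderiv]; simp
      have h1 : ∀ t, (B.precompR (Pt d)) (w t) (fderiv ℝ ρ (z - t)) u
          = Ω.indicator (fun t => -(v t * fderiv ℝ ψ t u)) t := by
        intro t
        simp only [ContinuousLinearMap.precompR_apply, hB, hfd, hw]
        by_cases ht : t ∈ Ω
        · simp [ht, mul_comm]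
        · simp [ht]
      simp only [h1]
      rw [integral_indicator hΩ.measurableSet, integral_neg, h.integral_mul_fderiv hT, neg_neg]
    have hψI : IntegrableOn ψ Ω :=
      (hψsm.continuous.integrable_of_hasCompactSupport hψcpt).integrableOn
    have hest : ∀ u, ‖convolution w (fderiv ℝ ρ) (B.precompR (Pt d)) volume z u‖ ≤ L * ‖u‖ := by
      intro u
      rw [happ u]
      have := norm_integral_le_of_norm_le (hψI.const_mul (L * ‖u‖))
        (f := fun t => inner ℝ u (g t) * ψ t) (by
          filter_upwards [hg] with t ht
          rw [norm_mul, Real.norm_of_nonneg (hψnn t)]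
          refine mul_le_mul_of_nonneg_right ?_ (hψnn t)
          calc ‖inner ℝ u (g t)‖ ≤ ‖u‖ * ‖g t‖ := norm_inner_le_norm _ _
            _ ≤ ‖u‖ * L := by gcongr
            _ = L * ‖u‖ := mul_comm _ _)
      rwa [integral_const_mul, hψΩ, mul_one] at this
    -- Since ψ has integral 1 over `Ω`, that set has positive measure and the bound on `g` holds at
    -- some point.
    have hL : 0 ≤ L := by
      have hne : (volume.restrict Ω) ≠ 0 := by
        intro h0
        rw [h0] at hψΩ
        simp at hψΩ
      have := (ae_neBot.2 hne)
      obtain ⟨t, ht⟩ := hg.exists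
      exact (norm_nonneg _).trans ht
    exact ContinuousLinearMap.opNorm_le_bound _ hL hest
  have hmv := (convex_segment x y).norm_image_sub_le_of_norm_hasFDerivWithin_le
    (fun z _ => (hder z).hasFDerivWithinAt) hbound (right_mem_segment ℝ x y)
    (left_mem_segment ℝ x y)
  have e₁ := hHdist x (left_mem_segment ℝ x y) fun t ht =>
    h₁ t (Metric.ball_subset_ball ((min_le_right _ _).trans (min_le_left _ _)) ht)
  have e₂ := hHdist y (right_mem_segment ℝ x y) fun t ht =>
    h₂ t (Metric.ball_subset_ball ((min_le_right _ _).trans (min_le_right _ _)) ht)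
  rw [Real.dist_eq] at e₁ e₂
  rw [Real.norm_eq_abs] at hmv
  have a₁ := abs_le.1 e₁
  have a₂ := abs_le.1 e₂
  have a₃ := abs_le.1 hmv
  rw [abs_le]
  constructor <;> linarith

/-! ### Geometry of triangulations -/

variable {𝒯 : Geometry.SimplicialComplex ℝ (Pt d)} {K : Finset (Pt d)}

/-- The vertices of an element form an affine basis. -/
def elementBasis (hK : K ∈ elements 𝒯) : AffineBasis K ℝ (Pt d) where
  toFun := (↑)
  ind' := 𝒯.indep hK.1
  tot' := by
    rw [(𝒯.indep hK.1).affineSpan_eq_top_iff_card_eq_finrank_add_one]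
    simp [hK.2]

theorem elementBasis_apply (hK : K ∈ elements 𝒯) (v : K) : elementBasis hK v = v := rfl

theorem range_elementBasis (hK : K ∈ elements 𝒯) :
    range (elementBasis hK) = (K : Set (Pt d)) := by
  ext x
  constructor
  · rintro ⟨v, rfl⟩; exact v.2
  · exact fun hx => ⟨⟨x, hx⟩, rfl⟩

theorem coord_vertex_eq_zero (hK : K ∈ elements 𝒯) {u v : K} (h : u ≠ v) :
    (elementBasis hK).coord u (v : Pt d) = 0 := by
  have := (elementBasis hK).coord_apply_ne h
  rwa [elementBasis_apply] at this

theorem mem_convexHull_iff_coord (hK : K ∈ elements 𝒯) {x : Pt d} :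
    x ∈ convexHull ℝ (K : Set (Pt d)) ↔ ∀ v, 0 ≤ (elementBasis hK).coord v x := by
  rw [← range_elementBasis hK, AffineBasis.convexHull_eq_nonneg_coord]; rfl

theorem exists_isBary {x : Pt d} (hx : x ∈ convexHull ℝ (K : Set (Pt d))) :
    ∃ c, IsBary K x c := by
  rw [Finset.mem_convexHull'] at hx
  exact hx

theorem IsBary.mem_convexHull {x : Pt d} {c : Pt d → ℝ} (hc : IsBary K x c) :
    x ∈ convexHull ℝ (K : Set (Pt d)) := by
  rw [Finset.mem_convexHull']
  exact ⟨c, hc⟩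

theorem IsBary.coord_eq (hK : K ∈ elements 𝒯) {x : Pt d} {c : Pt d → ℝ} (hc : IsBary K x c)
    (v : K) : (elementBasis hK).coord v x = c v := by
  have h1 : ∑ u : K, c u = 1 := (Finset.sum_coe_sort K c).trans hc.2.1
  have hx : x = Finset.univ.affineCombination ℝ (elementBasis hK) (fun u : K => c u) := by
    rw [Finset.affineCombination_eq_linear_combination _ _ _ h1]
    exact (hc.2.2.symm.trans (Finset.sum_coe_sort K fun u => c u • u).symm)
  conv_lhs => rw [hx]
  exact (elementBasis hK).coord_apply_combination_of_mem (Finset.mem_univ v) h1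

theorem isBary_coord (hK : K ∈ elements 𝒯) {x : Pt d}
    (hx : x ∈ convexHull ℝ (K : Set (Pt d))) :
    ∃ c, IsBary K x c ∧ ∀ v : K, c v = (elementBasis hK).coord v x := by
  obtain ⟨c, hc⟩ := exists_isBary hx
  exact ⟨c, hc, fun v => (hc.coord_eq hK v).symm⟩

/-- The components of the interpolant are affine on each element. -/
theorem lagrangeP1_affineOn (hK : K ∈ elements 𝒯) (w : Pt d → Pt d) :
    ∃ (g : Fin d → Pt d) (c : Fin d → ℝ), ∀ x ∈ convexHull ℝ (K : Set (Pt d)), ∀ i,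
      lagrangeP1 𝒯 w x i = inner ℝ (g i) x + c i := by
  set b := elementBasis hK
  have hcoord : ∀ v : K, ∃ a : Pt d, ∀ x, b.coord v x = inner ℝ a x + b.coord v 0 := by
    intro v
    refine ⟨(InnerProductSpace.toDual ℝ (Pt d)).symm
      (LinearMap.toContinuousLinearMap (b.coord v).linear), fun x => ?_⟩
    rw [InnerProductSpace.toDual_symm_apply]
    have := (b.coord v).linearMap_vsub x 0
    simp only [vsub_eq_sub, sub_zero] at this
    change _ = (b.coord v).linear x + _
    rw [this]; ring
  choose a ha using hcoord
  refine ⟨fun i => ∑ v : K, w v i • a v, fun i => ∑ v : K, w v i * b.coord v 0, fun x hx i => ?_⟩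
  obtain ⟨c, hc, hcv⟩ := isBary_coord hK hx
  rw [lagrangeP1_eq 𝒯 w hK hc, ← Finset.sum_coe_sort K (fun v => c v • w v)]
  simp only [hcv]
  rw [sum_inner, ← Finset.sum_add_distrib]
  simp only [WithLp.ofLp_sum, Finset.sum_apply, PiLp.smul_apply, smul_eq_mul, inner_smul_left]
  refine Finset.sum_congr rfl fun v _ => ?_
  change b.coord v x * _ = _
  rw [ha v x]
  simp; ring

theorem IsTriangulation.elements_finite {Ω : Set (Pt d)} (h : IsTriangulation 𝒯 Ω) :
    (elements 𝒯).Finite := h.1.subset fun _ hK => hK.1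

theorem IsTriangulation.mem_closure_iff {Ω : Set (Pt d)} (h : IsTriangulation 𝒯 Ω) {x : Pt d} :
    x ∈ closure Ω ↔ ∃ K ∈ elements 𝒯, x ∈ convexHull ℝ (K : Set (Pt d)) := by
  rw [← h.2.2, Geometry.SimplicialComplex.mem_space_iff]
  constructor
  · rintro ⟨s, hs, hx⟩
    obtain ⟨K, hK, hsK⟩ := h.2.1 s hs
    exact ⟨K, hK, convexHull_mono (Finset.coe_subset.2 hsK) hx⟩
  · rintro ⟨K, hK, hx⟩
    exact ⟨K, hK.1, hx⟩

theorem isCompact_convexHull_finset (K : Finset (Pt d)) :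
    IsCompact (convexHull ℝ (K : Set (Pt d))) := K.finite_toSet.isCompact_convexHull ℝ

theorem IsTriangulation.isCompact_closure {Ω : Set (Pt d)} (h : IsTriangulation 𝒯 Ω) :
    IsCompact (closure Ω) := by
  have : closure Ω = ⋃ K ∈ elements 𝒯, convexHull ℝ (K : Set (Pt d)) := by
    ext x; simp [h.mem_closure_iff]
  rw [this]
  exact h.elements_finite.isCompact_biUnion fun K _ => isCompact_convexHull_finset K

theorem IsTriangulation.interior_subset {Ω : Set (Pt d)} (h : IsTriangulation 𝒯 Ω)
    (hΩ : interior (closure Ω) = Ω) (hK : K ∈ elements 𝒯) :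
    interior (convexHull ℝ (K : Set (Pt d))) ⊆ Ω := by
  conv_rhs => rw [← hΩ]
  exact interior_mono fun x hx => h.mem_closure_iff.2 ⟨K, hK, hx⟩

/-- Almost every point of `Ω` is interior to an element. -/
theorem IsTriangulation.ae_mem_interior {Ω : Set (Pt d)} (h : IsTriangulation 𝒯 Ω) :
    ∀ᵐ x : Pt d, x ∈ Ω → ∃ K ∈ elements 𝒯, x ∈ interior (convexHull ℝ (K : Set (Pt d))) := by
  have : ∀ᵐ x : Pt d, ∀ K ∈ elements 𝒯, x ∉ frontier (convexHull ℝ (K : Set (Pt d))) :=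
    (ae_ball_iff h.elements_finite.countable).2 fun K _ =>
      measure_eq_zero_iff_ae_notMem.1 ((convex_convexHull ℝ _).addHaar_frontier volume)
  filter_upwards [this] with x hx hxΩ
  obtain ⟨K, hK, hxK⟩ := h.mem_closure_iff.1 (subset_closure hxΩ)
  refine ⟨K, hK, ?_⟩
  by_contra hn
  exact hx K hK ⟨subset_closure hxK, hn⟩

/-- An element that contains a point contains all vertices with positive barycentric coordinate
with respect to another element. -/
theorem IsBary.mem_of_mem_convexHull {M : Finset (Pt d)} (hK : K ∈ elements 𝒯)
    (hM : M ∈ elements 𝒯) {x : Pt d} {c : Pt d → ℝ} (hc : IsBary K x c)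
    (hx : x ∈ convexHull ℝ (M : Set (Pt d))) {u : Pt d} (hu : u ∈ K) (hcu : 0 < c u) : u ∈ M := by
  by_contra hn
  -- Conformity puts `x` in the hull of the common vertices; if `u` were not among them, its
  -- barycentric coordinate would vanish there.
  have hxi := 𝒯.inter_subset_convexHull hK.1 hM.1 ⟨hc.mem_convexHull, hx⟩
  have hsub : convexHull ℝ ((K : Set (Pt d)) ∩ M)
      ⊆ (elementBasis hK).coord ⟨u, hu⟩ ⁻¹' {0} := by
    refine convexHull_min ?_ ((convex_singleton 0).affine_preimage _)
    rintro z ⟨hzK, hzM⟩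
    have hzK' : z ∈ K := hzK
    have hne : (⟨u, hu⟩ : K) ≠ ⟨z, hzK'⟩ := by
      intro h
      exact hn ((Subtype.mk.inj h) ▸ hzM)
    have h0 := coord_vertex_eq_zero hK hne
    generalize (elementBasis hK).coord ⟨u, hu⟩ = f at h0
    exact h0
  have h0 : (elementBasis hK).coord ⟨u, hu⟩ x = 0 := hsub hxi
  rw [hc.coord_eq hK] at h0
  exact hcu.ne' h0

/-- Extension by zero transfers barycentric coordinates to any simplex that contains the vertices
carrying `x`. -/
theorem IsBary.of_support_subset {M : Finset (Pt d)} {x : Pt d} {c : Pt d → ℝ}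
    (hc : IsBary K x c) (h : ∀ u ∈ K, 0 < c u → u ∈ M) :
    ∃ c', IsBary M x c' ∧ ∀ u ∈ K, c' u = c u := by
  classical
  have hz : ∀ u ∈ K, u ∉ M ∩ K → c u = 0 := fun u hu hn => by
    by_contra h0
    exact hn (Finset.mem_inter.2 ⟨h u hu (lt_of_le_of_ne (hc.1 u hu) (Ne.symm h0)), hu⟩)
  refine ⟨fun u => if u ∈ K then c u else 0, ⟨fun u _ => ?_, ?_, ?_⟩, fun u hu => if_pos hu⟩
  · dsimp only
    split_ifs with hu
    exacts [hc.1 u hu, le_rfl]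
  · rw [Finset.sum_ite_mem, ← hc.2.1]
    exact Finset.sum_subset Finset.inter_subset_right hz
  · simp only [ite_smul, zero_smul]
    rw [Finset.sum_ite_mem, ← hc.2.2]
    exact Finset.sum_subset Finset.inter_subset_right fun u hu hn => by
      rw [hz u hu hn, zero_smul]

/-- The translation is by (1 - t)(v - x). A coordinate that vanishes at `x` belongs to a vertex
other than `v`, so it vanishes at `v` too and the translation leaves it unchanged. A coordinate
positive at `x` stays positive near `x`. -/
theorem eventually_coord_nonneg {M : Finset (Pt d)} (hM : M ∈ elements 𝒯) {x : Pt d}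
    {c : Pt d → ℝ} (hc : IsBary M x c) {v : Pt d} (hv : v ∈ M) (hcv : 0 < c v) (t : ℝ) (u : M) :
    ∀ᶠ y in 𝓝 x, 0 ≤ (elementBasis hM).coord u (y + ((v + t • (x - v)) - x)) →
      0 ≤ (elementBasis hM).coord u y := by
  have hux := hc.coord_eq hM u
  have hzero : u ≠ ⟨v, hv⟩ → (elementBasis hM).coord u v = 0 := fun h =>
    coord_vertex_eq_zero hM (v := ⟨v, hv⟩) h
  generalize (elementBasis hM).coord u = f at hux hzero
  have hcont : Continuous f := f.continuous_of_finiteDimensional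
  rcases (hc.1 u u.2).eq_or_lt with h0 | h0
  · have hxu : f x = 0 := by rw [hux, ← h0]
    have huv : u ≠ ⟨v, hv⟩ := by
      rintro rfl
      exact hcv.ne h0
    refine Eventually.of_forall fun y hy => ?_
    have e : y + ((v + t • (x - v)) - x) = y + ((1 - t) • v - (1 - t) • x) := by module
    have l1 := f.linearMap_vsub (y + ((1 - t) • v - (1 - t) • x)) y
    have l2 := f.linearMap_vsub v x
    simp only [vsub_eq_sub, add_sub_cancel_left, ← smul_sub, map_smul] at l1 l2
    rw [l2, hzero huv, hxu] at l1
    rw [e, ← smul_sub] at hy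
    simp only [sub_zero, smul_zero] at l1
    linarith
  · have : 0 < f x := by rwa [hux]
    filter_upwards [hcont.continuousAt.eventually (lt_mem_nhds this)] with y hy _
    exact le_of_lt hy

/-- If a vertex with positive barycentric coordinate at `x` is an interior point of the
triangulated set, then so is `x`. -/
theorem mem_interior_of_vertex {Ω : Set (Pt d)} (h : IsTriangulation 𝒯 Ω)
    (hK : K ∈ elements 𝒯) {x : Pt d} {c : Pt d → ℝ} (hc : IsBary K x c) {v : Pt d} (hv : v ∈ K)
    (hcv : 0 < c v) (hvi : v ∈ interior (closure Ω)) : x ∈ interior (closure Ω) := by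
  classical
  -- A point `p` of the open segment from `v` to `x`, close to `v`, is interior and still gives
  -- positive weight to every vertex that carries `x`.
  obtain ⟨t, ht0, ht1, htp⟩ : ∃ t : ℝ, 0 < t ∧ t < 1 ∧ v + t • (x - v) ∈ interior (closure Ω) := by
    have hcont : Tendsto (fun t : ℝ => v + t • (x - v)) (𝓝[>] 0) (𝓝 v) := by
      have : Continuous fun t : ℝ => v + t • (x - v) := by fun_prop
      have := this.tendsto 0
      simp only [zero_smul, add_zero] at this
      exact this.mono_left nhdsWithin_le_nhds
    have h1 := hcont (isOpen_interior.mem_nhds hvi)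
    have h2 : ∀ᶠ t : ℝ in 𝓝[>] 0, t ∈ Ioo (0 : ℝ) 1 := Ioo_mem_nhdsGT zero_lt_one
    obtain ⟨t, ht, ht'⟩ := (h2.and h1).exists
    exact ⟨t, ht.1, ht.2, ht'⟩
  set p := v + t • (x - v) with hp
  have hpb : IsBary K p fun u => (1 - t) * (if u = v then 1 else 0) + t * c u := by
    refine ⟨fun u hu => ?_, ?_, ?_⟩
    · have := hc.1 u hu
      have : 0 ≤ 1 - t := by linarith
      positivity
    · rw [Finset.sum_add_distrib, ← Finset.mul_sum, ← Finset.mul_sum, hc.2.1,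
        Finset.sum_ite_eq' K v, if_pos hv]
      ring
    · simp only [add_smul, mul_smul, ite_smul, one_smul, zero_smul]
      rw [Finset.sum_add_distrib, ← Finset.smul_sum, ← Finset.smul_sum, hc.2.2,
        Finset.sum_ite_eq' K v, if_pos hv, hp]
      module
  have hq : Tendsto (fun y : Pt d => y + (p - x)) (𝓝 x) (𝓝 p) := by
    have : Continuous fun y : Pt d => y + (p - x) := by fun_prop
    have := this.tendsto x
    rwa [add_sub_cancel] at this
  have e1 : ∀ᶠ y in 𝓝 x, y + (p - x) ∈ closure Ω :=
    (hq.eventually (isOpen_interior.mem_nhds htp)).mono fun y hy => _root_.interior_subset hy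
  -- Elements missing `p` are avoided near `p`. An element containing `p` contains all vertices
  -- carrying `x`, and membership then passes back from near `p` to near `x` coordinate by
  -- coordinate.
  have e2 : ∀ᶠ y in 𝓝 x, ∀ M ∈ elements 𝒯, y + (p - x) ∈ convexHull ℝ (M : Set (Pt d)) →
      y ∈ convexHull ℝ (M : Set (Pt d)) := by
    rw [h.elements_finite.eventually_all]
    intro M hM
    by_cases hpM : p ∈ convexHull ℝ (M : Set (Pt d))
    swap
    · filter_upwards [hq ((isCompact_convexHull_finset M).isClosed.isOpen_compl.mem_nhds hpM)]
        with y hy hy'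
      exact absurd hy' hy
    have hKM : ∀ u ∈ K, 0 < c u → u ∈ M := fun u hu hcu =>
      hpb.mem_of_mem_convexHull hK hM hpM hu (by
        have : 0 ≤ 1 - t := by linarith
        have : 0 < t * c u := mul_pos ht0 hcu
        positivity)
    obtain ⟨c', hc', hcc⟩ := hc.of_support_subset hKM
    have hvM := hKM v hv hcv
    have hall : ∀ u : M, ∀ᶠ y in 𝓝 x, 0 ≤ (elementBasis hM).coord u (y + (p - x)) →
        0 ≤ (elementBasis hM).coord u y := fun u =>
      eventually_coord_nonneg hM hc' hvM (hcc v hv ▸ hcv) t u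
    filter_upwards [eventually_all.2 hall] with y hy hyM
    rw [mem_convexHull_iff_coord hM] at hyM ⊢
    exact fun u => hy u (hyM u)
  rw [mem_interior_iff_mem_nhds]
  filter_upwards [e1, e2] with y hy1 hy2
  obtain ⟨M, hM, hyM⟩ := h.mem_closure_iff.1 hy1
  exact h.mem_closure_iff.2 ⟨M, hM, hy2 M hM hyM⟩

/-- The interpolant of a field that vanishes on the boundary vanishes outside `Ω`. -/
theorem lagrangeP1_eq_zero {Ω : Set (Pt d)} (h : IsTriangulation 𝒯 Ω)
    (hΩo : IsOpen Ω) (hΩ : interior (closure Ω) = Ω) {w : Pt d → Pt d} (hw : ∀ x ∈ frontier Ω, w x = 0)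
    {x : Pt d} (hx : x ∉ Ω) : lagrangeP1 𝒯 w x = 0 := by
  by_cases hxc : x ∈ closure Ω
  · obtain ⟨K, hK, hxK⟩ := h.mem_closure_iff.1 hxc
    obtain ⟨c, hc⟩ := exists_isBary hxK
    rw [lagrangeP1_eq 𝒯 w hK hc]
    refine Finset.sum_eq_zero fun v hv => ?_
    rcases (hc.1 v hv).eq_or_lt with h0 | h0
    · rw [← h0, zero_smul]
    -- A vertex of positive weight lies on the boundary: were it in `Ω`, the point `x` would be too.
    · rw [hw v, smul_zero]
      rw [hΩo.frontier_eq]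
      refine ⟨h.mem_closure_iff.2 ⟨K, hK, subset_convexHull ℝ _ hv⟩, fun hvΩ => hx ?_⟩
      rw [← hΩ] at hvΩ ⊢
      exact mem_interior_of_vertex h hK hc hv h0 hvΩ
  · rw [lagrangeP1, dif_neg]
    rintro ⟨p, hp, hb⟩
    exact hxc (h.mem_closure_iff.2 ⟨p.1, hp, hb.mem_convexHull⟩)

/-! ### The seminorm `|w|_{1,∞}` -/

theorem weakJac_sq_sum (Ω : Set (Pt d)) (w : Pt d → Pt d) (x : Pt d) :
    ∑ i, ∑ j, (weakJac Ω w x i j) ^ 2 = ∑ i, ‖weakGrad Ω (fun y => w y i) x‖ ^ 2 := by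
  simp [weakJac, EuclideanSpace.norm_sq_eq]

theorem ae_sum_le_of_semiW1inf_le {Ω : Set (Pt d)} {w : Pt d → Pt d} {L : ℝ} (hL : 0 ≤ L)
    (h : semiW1inf Ω w ≤ ENNReal.ofReal L) :
    ∀ᵐ x ∂volume.restrict Ω, ∑ i, ‖weakGrad Ω (fun y => w y i) x‖ ^ 2 ≤ L ^ 2 := by
  rw [semiW1inf, eLpNorm_exponent_top] at h
  filter_upwards [ae_le_eLpNormEssSup (μ := volume.restrict Ω)
    (f := fun x => Real.sqrt (∑ i, ∑ j, (weakJac Ω w x i j) ^ 2))] with x hx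
  have h1 := hx.trans h
  rw [← ofReal_norm, ENNReal.ofReal_le_ofReal_iff hL,
    Real.norm_of_nonneg (Real.sqrt_nonneg _), Real.sqrt_le_left hL, weakJac_sq_sum] at h1
  exact h1

theorem semiW1inf_le_of_ae_sum_le {Ω : Set (Pt d)} {w : Pt d → Pt d} {L : ℝ} (hL : 0 ≤ L)
    (h : ∀ᵐ x ∂volume.restrict Ω, ∑ i, ‖weakGrad Ω (fun y => w y i) x‖ ^ 2 ≤ L ^ 2) :
    semiW1inf Ω w ≤ ENNReal.ofReal L := by
  rw [semiW1inf, eLpNorm_exponent_top]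
  refine eLpNormEssSup_le_of_ae_bound ?_
  filter_upwards [h] with x hx
  rw [Real.norm_of_nonneg (Real.sqrt_nonneg _), weakJac_sq_sum]
  exact Real.sqrt_le_iff.2 ⟨hL, hx⟩

/-- The Frobenius norm dominates the operator norm, so `|·|_{1,∞}` is itself a Lipschitz constant,
without a dimensional factor. -/
theorem norm_le_of_sum_sq_le {g : Fin d → Pt d} {L : ℝ} (hL : 0 ≤ L) (hg : ∑ i, ‖g i‖ ^ 2 ≤ L ^ 2)
    {z e : Pt d} (hz : ∀ i, z i = inner ℝ (g i) e) : ‖z‖ ≤ L * ‖e‖ := by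
  refine (sq_le_sq₀ (norm_nonneg _) (by positivity)).1 ?_
  rw [EuclideanSpace.norm_sq_eq, mul_pow]
  calc ∑ i, ‖z i‖ ^ 2 ≤ ∑ i, ‖g i‖ ^ 2 * ‖e‖ ^ 2 := by
        refine Finset.sum_le_sum fun i _ => ?_
        rw [hz i, ← mul_pow]
        gcongr
        exact norm_inner_le_norm _ _
    _ ≤ L ^ 2 * ‖e‖ ^ 2 := by
        rw [← Finset.sum_mul]; gcongr

theorem interior_element_nonempty (hK : K ∈ elements 𝒯) :
    (interior (convexHull ℝ (K : Set (Pt d)))).Nonempty := by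
  rw [← range_elementBasis hK]
  exact interior_convexHull_nonempty_iff_affineSpan_eq_top.2 (elementBasis hK).tot

/-- The gradient of the interpolant on an element is the weak gradient, if that exists. -/
theorem ae_weakGrad_lagrangeP1 {Ω : Set (Pt d)} (h : IsTriangulation 𝒯 Ω)
    (hΩ : interior (closure Ω) = Ω) (hK : K ∈ elements 𝒯) {w : Pt d → Pt d} {g : Fin d → Pt d}
    {c : Fin d → ℝ} (hg : ∀ x ∈ convexHull ℝ (K : Set (Pt d)), ∀ i,
      lagrangeP1 𝒯 w x i = inner ℝ (g i) x + c i) (i : Fin d)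
    (hw : HasWeakGrad Ω fun y => lagrangeP1 𝒯 w y i) :
    ∀ᵐ x, x ∈ interior (convexHull ℝ (K : Set (Pt d))) →
      weakGrad Ω (fun y => lagrangeP1 𝒯 w y i) x = g i :=
  weakGrad_eq_of_affineOn isOpen_interior (h.interior_subset hΩ hK) hw (g i) (c i)
    fun x hx => hg x (_root_.interior_subset hx) i

theorem lipschitzOnWith_lagrangeP1 {w : Pt d → Pt d} {g : Fin d → Pt d}
    {c : Fin d → ℝ} (hg : ∀ x ∈ convexHull ℝ (K : Set (Pt d)), ∀ i,
      lagrangeP1 𝒯 w x i = inner ℝ (g i) x + c i) {L : ℝ} (hL : 0 ≤ L)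
    (hgL : ∑ i, ‖g i‖ ^ 2 ≤ L ^ 2) :
    LipschitzOnWith L.toNNReal (lagrangeP1 𝒯 w) (convexHull ℝ (K : Set (Pt d))) := by
  refine LipschitzOnWith.of_dist_le_mul fun x hx y hy => ?_
  rw [dist_eq_norm, dist_eq_norm, Real.coe_toNNReal _ hL]
  refine norm_le_of_sum_sq_le hL hgL fun i => ?_
  rw [PiLp.sub_apply, hg x hx i, hg y hy i, inner_sub_right]
  ring

/-- The elements and the complement of `Ω`, where the interpolant is zero, form a finite closed
cover of the whole space. Working on ℝ^d avoids any convexity assumption on `Ω`. -/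
theorem lipschitzWith_lagrangeP1_of_elements {Ω : Set (Pt d)} (h : IsTriangulation 𝒯 Ω)
    (hΩo : IsOpen Ω) (hΩ : interior (closure Ω) = Ω) {w : Pt d → Pt d}
    (hw : ∀ x ∈ frontier Ω, w x = 0) {L : NNReal}
    (hL : ∀ K ∈ elements 𝒯, LipschitzOnWith L (lagrangeP1 𝒯 w) (convexHull ℝ (K : Set (Pt d)))) :
    LipschitzWith L (lagrangeP1 𝒯 w) := by
  have := h.elements_finite.to_subtype
  refine lipschitzWith_of_finite_closed_cover (ι := Option (elements 𝒯))
    (C := fun o => o.elim Ωᶜ fun K => convexHull ℝ (K.1 : Set (Pt d))) ?_ ?_ ?_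
  · rintro (_ | K)
    exacts [hΩo.isClosed_compl, (isCompact_convexHull_finset K.1).isClosed]
  · refine eq_univ_of_forall fun x => ?_
    by_cases hx : x ∈ Ω
    · obtain ⟨K, hK, hxK⟩ := h.mem_closure_iff.1 (subset_closure hx)
      exact mem_iUnion.2 ⟨some ⟨K, hK⟩, hxK⟩
    · exact mem_iUnion.2 ⟨none, hx⟩
  · rintro (_ | K)
    · refine LipschitzOnWith.of_dist_le_mul fun x hx y hy => ?_
      rw [lagrangeP1_eq_zero h hΩo hΩ hw hx, lagrangeP1_eq_zero h hΩo hΩ hw hy, dist_self]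
      positivity
    · exact hL K.1 K.2

/-- The interpolant of a field that vanishes on the boundary is Lipschitz on the whole space with
constant `|Π_h w|_{1,∞}`. -/
theorem lipschitzWith_lagrangeP1 {Ω : Set (Pt d)} (h : IsTriangulation 𝒯 Ω)
    (hΩo : IsOpen Ω) (hΩ : interior (closure Ω) = Ω) {w : Pt d → Pt d}
    (hw : ∀ x ∈ frontier Ω, w x = 0) {L : ℝ} (hL : 0 ≤ L)
    (hs : semiW1inf Ω (lagrangeP1 𝒯 w) ≤ ENNReal.ofReal L) :
    LipschitzWith L.toNNReal (lagrangeP1 𝒯 w) := by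
  have hfin := h.elements_finite.to_subtype
  choose g c hg using fun K : elements 𝒯 => lagrangeP1_affineOn K.2 w
  obtain ⟨M, hM⟩ : ∃ M : ℝ, ∀ K, Real.sqrt (∑ i, ‖g K i‖ ^ 2) ≤ M := by
    obtain ⟨M, hM⟩ := (finite_range fun K => Real.sqrt (∑ i, ‖g K i‖ ^ 2)).bddAbove
    exact ⟨M, fun K => hM (mem_range_self K)⟩
  -- A crude constant, the largest elementwise gradient, comes first: it provides the weak gradient.
  -- Without one, `weakGrad` would be 0 by default and `hs` would carry no information.
  have hlip : LipschitzWith (|M|).toNNReal (lagrangeP1 𝒯 w) :=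
    lipschitzWith_lagrangeP1_of_elements h hΩo hΩ hw fun K hK =>
      lipschitzOnWith_lagrangeP1 (hg ⟨K, hK⟩) (abs_nonneg M)
        (Real.sqrt_le_left (abs_nonneg M) |>.1 ((hM ⟨K, hK⟩).trans (le_abs_self M)))
  have hweak : ∀ i, HasWeakGrad Ω fun y => lagrangeP1 𝒯 w y i := fun i =>
    hasWeakGrad_of_lipschitz (((EuclideanSpace.proj (𝕜 := ℝ) i).lipschitz).comp hlip)
  refine lipschitzWith_lagrangeP1_of_elements h hΩo hΩ hw fun K hK =>
    lipschitzOnWith_lagrangeP1 (hg ⟨K, hK⟩) hL ?_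
  have h1 := ae_all_iff.2 fun i => ae_weakGrad_lagrangeP1 h hΩ hK (hg ⟨K, hK⟩) i (hweak i)
  have h2 := (ae_restrict_iff' hΩo.measurableSet).1 (ae_sum_le_of_semiW1inf_le hL hs)
  have hpos : volume (interior (convexHull ℝ (K : Set (Pt d)))) ≠ 0 :=
    (isOpen_interior.measure_pos volume (interior_element_nonempty hK)).ne'
  -- The gradient is constant on the element, so one good point in its interior turns the a.e. bound
  -- into a bound for `g`.
  obtain ⟨x, hxK, hx⟩ := Measure.exists_mem_of_measure_ne_zero_of_ae hpos
    (ae_restrict_of_ae (h1.and h2))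
  have := hx.2 (h.interior_subset hΩ hK hxK)
  simpa only [hx.1 _ hxK] using this

/-! ### Stability of interpolation -/

/-- Convex combinations of the vertex values cannot oscillate more than the vertex values
themselves. -/
theorem IsBary.sub_le {u : Pt d → ℝ} {D : ℝ} (hD : ∀ v ∈ K, ∀ v' ∈ K, u v - u v' ≤ D)
    {x y : Pt d} {a b : Pt d → ℝ} (ha : IsBary K x a) (hb : IsBary K y b) :
    ∑ v ∈ K, a v * u v - ∑ v ∈ K, b v * u v ≤ D := by
  have h1 : ∀ v' ∈ K, ∑ v ∈ K, a v * u v ≤ u v' + D := by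
    intro v' hv'
    calc ∑ v ∈ K, a v * u v ≤ ∑ v ∈ K, a v * (u v' + D) :=
          Finset.sum_le_sum fun v hv =>
            mul_le_mul_of_nonneg_left (by linarith [hD v hv v' hv']) (ha.1 v hv)
      _ = u v' + D := by rw [← Finset.sum_mul, ha.2.1, one_mul]
  have h2 : ∑ v ∈ K, b v * (∑ v ∈ K, a v * u v - D) ≤ ∑ v ∈ K, b v * u v :=
    Finset.sum_le_sum fun v hv =>
      mul_le_mul_of_nonneg_left (by linarith [h1 v hv]) (hb.1 v hv)
  rw [← Finset.sum_mul, hb.2.1, one_mul] at h2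
  linarith

/-- Inverse estimate: the gradient of an affine function on a set that contains a ball of
radius `r` is controlled by its oscillation. -/
theorem norm_le_of_oscillation_le {S : Set (Pt d)} {f : Pt d → ℝ} {g : Pt d} {c : ℝ}
    (hf : ∀ x ∈ S, f x = inner ℝ g x + c) {x₀ : Pt d} {r D : ℝ} (hr : 0 < r)
    (hball : Metric.closedBall x₀ r ⊆ S) (hD : ∀ x ∈ S, ∀ y ∈ S, f x - f y ≤ D) :
    2 * r * ‖g‖ ≤ D := by
  rcases eq_or_ne g 0 with rfl | hg
  · have hx := hball (Metric.mem_closedBall_self hr.le)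
    simpa using hD x₀ hx x₀ hx
  have hgn : ‖g‖ ≠ 0 := norm_ne_zero_iff.2 hg
  -- The two ends of the diameter along `g` realise the difference 2r‖g‖.
  set e : Pt d := (r / ‖g‖) • g with he
  have hen : ‖e‖ = r := by
    rw [he, norm_smul, norm_div, norm_norm, Real.norm_of_nonneg hr.le, div_mul_cancel₀ _ hgn]
  have h1 : x₀ + e ∈ S := hball (by simp [Metric.mem_closedBall, hen])
  have h2 : x₀ - e ∈ S := hball (by simp [Metric.mem_closedBall, hen])
  have h3 := hD _ h1 _ h2
  rw [hf _ h1, hf _ h2, inner_add_right, inner_sub_right] at h3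
  have h4 : inner ℝ g e = r * ‖g‖ := by
    rw [he, real_inner_smul_right, real_inner_self_eq_norm_sq]
    field_simp
  linarith

theorem exists_interpConst {Ω : Set (Pt d)} (hd : 0 < d) (hΩo : IsOpen Ω)
    (hΩ : interior (closure Ω) = Ω) {𝔗 : Set (Geometry.SimplicialComplex ℝ (Pt d))}
    (h𝔗 : IsRegularFamily 𝔗 Ω) : ∃ α, IsInterpConst Ω 𝔗 α := by
  obtain ⟨hT, σ, hσ, hreg⟩ := h𝔗
  -- On `K` each component of the interpolant oscillates by at most L diam K ≤ Lσ·2r, so its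
  -- gradient is at most σL; the Frobenius norm of d such rows gives √d.
  refine ⟨max 1 (Real.sqrt d * σ), le_max_left _ _, fun 𝒯 h𝒯 w hw => ?_⟩
  have h := hT 𝒯 h𝒯
  rcases eq_or_ne (semiW1inf Ω w) ∞ with htop | htop
  · rw [htop, ENNReal.mul_top]
    · exact le_top
    · exact (ENNReal.ofReal_pos.2 (lt_max_of_lt_left one_pos)).ne'
  set L := (semiW1inf Ω w).toReal with hLdef
  have hL : 0 ≤ L := ENNReal.toReal_nonneg
  have hsemi : semiW1inf Ω w = ENNReal.ofReal L := (ENNReal.ofReal_toReal htop).symm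
  have hae := ae_sum_le_of_semiW1inf_le hL hsemi.le
  have hfinite : IsFiniteMeasure (volume.restrict Ω) := isFiniteMeasure_restrict.2
    ((measure_mono subset_closure).trans_lt h.isCompact_closure.measure_lt_top).ne
  have hlip : ∀ K ∈ elements 𝒯, ∀ i, LipschitzOnWith L.toNNReal (fun x => w x i)
      (convexHull ℝ (K : Set (Pt d))) := by
    -- The interior of `K` is convex and inside `Ω`, so the segment estimate applies there;
    -- continuity of `w` up to the closure extends it to `K`.
    intro K hK i
    have hcl : closure (interior (convexHull ℝ (K : Set (Pt d)))) = convexHull ℝ (K : Set (Pt d)) := by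
      rw [(convex_convexHull ℝ _).closure_interior_eq_closure_of_nonempty_interior
        (interior_element_nonempty hK), (isCompact_convexHull_finset K).isClosed.closure_eq]
    have hwc : ContinuousOn (fun x => w x i) (closure Ω) :=
      (EuclideanSpace.proj (𝕜 := ℝ) i).continuous.comp_continuousOn hw.1
    rw [← hcl]
    refine LipschitzOnWith.closure ?_ ?_
    · rw [hcl]
      exact hwc.mono fun x hx => h.mem_closure_iff.2 ⟨K, hK, hx⟩
    · refine LipschitzOnWith.of_dist_le_mul fun x hx y hy => ?_
      rw [Real.dist_eq, dist_eq_norm, Real.coe_toNNReal _ hL]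
      refine (isWeakGrad_weakGrad (hw.2.2 i).1).abs_sub_le_of_segment_subset hΩo
        (hwc.mono subset_closure) ((hw.2.1.eval_piLp i).integrable le_top) ?_ ?_
      · filter_upwards [hae] with x hx
        refine (sq_le_sq₀ (norm_nonneg _) hL).1 (le_trans ?_ hx)
        exact Finset.single_le_sum
          (f := fun i => ‖weakGrad Ω (fun y => w y i) x‖ ^ 2) (fun _ _ => by positivity)
          (Finset.mem_univ i)
      · exact (((convex_convexHull ℝ _).interior).segment_subset hx hy).trans
          (h.interior_subset hΩ hK)
  have hgrad : ∀ K ∈ elements 𝒯, ∀ᵐ x, x ∈ interior (convexHull ℝ (K : Set (Pt d))) →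
      ∀ i, ‖weakGrad Ω (fun y => lagrangeP1 𝒯 w y i) x‖ ≤ σ * L := by
    intro K hK
    obtain ⟨g, c, hg⟩ := lagrangeP1_affineOn hK w
    obtain ⟨x₀, r, hdiam, hball⟩ := hreg 𝒯 h𝒯 K hK
    have hbdd : Bornology.IsBounded (convexHull ℝ (K : Set (Pt d))) :=
      (isCompact_convexHull_finset K).isBounded
    have hr : 0 < r := by
      have hcard : 1 < K.card := by rw [hK.2]; omega
      obtain ⟨a, ha, b, hb, hab⟩ := Finset.one_lt_card.1 hcard
      have h1 := Metric.dist_le_diam_of_mem hbdd (subset_convexHull ℝ _ ha)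
        (subset_convexHull ℝ _ hb)
      have h2 : 0 < σ * (2 * r) := (dist_pos.2 hab).trans_le (h1.trans hdiam)
      have := pos_of_mul_pos_right h2 hσ.le
      linarith
    have hgi : ∀ i, ‖g i‖ ≤ σ * L := by
      intro i
      have := norm_le_of_oscillation_le (f := fun x => lagrangeP1 𝒯 w x i)
        (fun x hx => hg x hx i) hr hball (D := L * (σ * (2 * r))) (by
          intro x hx y hy
          obtain ⟨a, ha⟩ := exists_isBary hx
          obtain ⟨b, hb⟩ := exists_isBary hy
          rw [lagrangeP1_eq 𝒯 w hK ha, lagrangeP1_eq 𝒯 w hK hb]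
          simp only [WithLp.ofLp_sum, Finset.sum_apply, PiLp.smul_apply, smul_eq_mul]
          refine IsBary.sub_le (fun v hv v' hv' => ?_) ha hb
          have hv := subset_convexHull ℝ (K : Set (Pt d)) hv
          have hv' := subset_convexHull ℝ (K : Set (Pt d)) hv'
          have h1 := (hlip K hK i).dist_le_mul v hv v' hv'
          rw [Real.coe_toNNReal _ hL, Real.dist_eq] at h1
          refine (le_abs_self _).trans (h1.trans ?_)
          gcongr
          exact (Metric.dist_le_diam_of_mem hbdd hv hv').trans hdiam)
      have h2r : 0 < 2 * r := by linarith
      refine le_of_mul_le_mul_left ?_ h2r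
      calc 2 * r * ‖g i‖ ≤ L * (σ * (2 * r)) := this
        _ = 2 * r * (σ * L) := by ring
    have hall : ∀ i, ∀ᵐ x, x ∈ interior (convexHull ℝ (K : Set (Pt d))) →
        ‖weakGrad Ω (fun y => lagrangeP1 𝒯 w y i) x‖ ≤ σ * L := by
      intro i
      by_cases hwg : HasWeakGrad Ω fun y => lagrangeP1 𝒯 w y i
      · filter_upwards [ae_weakGrad_lagrangeP1 h hΩ hK hg i hwg] with x hx hxK
        rw [hx hxK]; exact hgi i
      -- Here `weakGrad` takes its default value 0, for which the bound is trivial.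
      · refine Eventually.of_forall fun x _ => ?_
        rw [weakGrad_of_not hwg]
        simpa using mul_nonneg hσ.le hL
    filter_upwards [ae_all_iff.2 hall] with x hx hxK i using hx i hxK
  have hfinal : semiW1inf Ω (lagrangeP1 𝒯 w) ≤ ENNReal.ofReal (Real.sqrt d * σ * L) := by
    refine semiW1inf_le_of_ae_sum_le (by positivity) ((ae_restrict_iff' hΩo.measurableSet).2 ?_)
    filter_upwards [h.ae_mem_interior, (ae_ball_iff h.elements_finite.countable).2 hgrad]
      with x hx1 hx2 hxΩ
    obtain ⟨K, hK, hxK⟩ := hx1 hxΩ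
    calc ∑ i, ‖weakGrad Ω (fun y => lagrangeP1 𝒯 w y i) x‖ ^ 2
        ≤ ∑ _i : Fin d, (σ * L) ^ 2 := by
          gcongr with i
          exact hx2 K hK hxK i
      _ = (Real.sqrt d * σ * L) ^ 2 := by
          rw [Finset.sum_const, Finset.card_univ, Fintype.card_fin, nsmul_eq_mul, mul_assoc,
            mul_pow (Real.sqrt d), Real.sq_sqrt d.cast_nonneg]
  rw [hsemi, ← ENNReal.ofReal_mul (by positivity)]
  exact hfinal.trans (ENNReal.ofReal_le_ofReal (by gcongr; exact le_max_right _ _))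

/-! ### The Jacobian of the upwind map -/

theorem exists_jacobianConst (Ω : Set (Pt d)) : ∃ δ, IsJacobianConst Ω δ := by
  have hcont : Continuous fun A : Matrix (Fin d) (Fin d) ℝ => (1 - A).det :=
    (continuous_const.sub continuous_id).matrix_det
  have hnhds : ∀ᶠ A in 𝓝 (0 : Matrix (Fin d) (Fin d) ℝ), (1 - A).det ∈ Icc (1 / 2 : ℝ) (3 / 2) := by
    refine hcont.continuousAt.eventually (Icc_mem_nhds ?_ ?_) <;> norm_num
  -- On the function space the ball is that of the sup norm, so entrywise bounds suffice.
  have hnhds' : ∀ᶠ A in 𝓝 (0 : Fin d → Fin d → ℝ),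
      (1 - Matrix.of A).det ∈ Icc (1 / 2 : ℝ) (3 / 2) := hnhds
  obtain ⟨ε, hε, hball⟩ := Metric.eventually_nhds_iff.1 hnhds'
  refine ⟨min (1 / 2) (ε / 2), by positivity, (min_le_left _ _).trans_lt (by norm_num),
    fun w _ Δt hΔt hle => ?_⟩
  set δ := min (1 / 2) (ε / 2) with hδ
  have hδpos : 0 < δ := by positivity
  have hsemi : semiW1inf Ω w ≤ ENNReal.ofReal (δ / Δt) := by
    rw [ENNReal.ofReal_div_of_pos hΔt]
    refine (ENNReal.le_div_iff_mul_le (Or.inl (ENNReal.ofReal_pos.2 hΔt).ne')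
      (Or.inl ENNReal.ofReal_ne_top)).2 ?_
    rwa [mul_comm]
  filter_upwards [ae_sum_le_of_semiW1inf_le (by positivity) hsemi] with x hx
  refine hball (y := fun i j => Δt * weakJac Ω w x i j) ?_
  rw [dist_zero_right]
  refine lt_of_le_of_lt ((pi_norm_le_iff_of_nonneg hδpos.le).2 fun i =>
    (pi_norm_le_iff_of_nonneg hδpos.le).2 fun j => ?_) ((min_le_right _ _).trans_lt (half_lt_self hε))
  rw [← weakJac_sq_sum] at hx
  have h1 : (weakJac Ω w x i j) ^ 2 ≤ (δ / Δt) ^ 2 := by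
    refine le_trans ?_ hx
    refine le_trans ?_ (Finset.single_le_sum (f := fun i => ∑ j, (weakJac Ω w x i j) ^ 2)
      (fun _ _ => Finset.sum_nonneg fun _ _ => sq_nonneg _) (Finset.mem_univ i))
    exact Finset.single_le_sum (f := fun j => (weakJac Ω w x i j) ^ 2)
      (fun _ _ => sq_nonneg _) (Finset.mem_univ j)
  have h2 := abs_le_of_sq_le_sq h1 (by positivity)
  rw [norm_mul, Real.norm_of_nonneg hΔt.le, Real.norm_eq_abs]
  calc Δt * |weakJac Ω w x i j| ≤ Δt * (δ / Δt) := by gcongr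
    _ = δ := by field_simp

/-! ### Transport along the upwind map -/

theorem antilipschitzWith_X1 {w : Pt d → Pt d} {L Δt : ℝ} (hL : 0 ≤ L) (hΔt : 0 < Δt)
    (hw : LipschitzWith L.toNNReal w) (hs : Δt * L < 1) :
    AntilipschitzWith (1 - Δt * L)⁻¹.toNNReal (X1 Δt w) := by
  have hpos : 0 < 1 - Δt * L := by linarith
  refine AntilipschitzWith.of_le_mul_dist fun x y => ?_
  rw [Real.coe_toNNReal _ (inv_pos.2 hpos).le, dist_eq_norm, dist_eq_norm, ← div_eq_inv_mul,
    le_div_iff₀ hpos]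
  have h1 := hw.dist_le_mul x y
  rw [Real.coe_toNNReal _ hL, dist_eq_norm, dist_eq_norm] at h1
  have h2 : x - y = (X1 Δt w x - X1 Δt w y) + Δt • (w x - w y) := by
    simp only [X1]; module
  have h3 : ‖x - y‖ ≤ ‖X1 Δt w x - X1 Δt w y‖ + Δt * ‖w x - w y‖ := by
    conv_lhs => rw [h2]
    refine (norm_add_le _ _).trans_eq ?_
    rw [norm_smul, Real.norm_of_nonneg hΔt.le]
  have h4 : Δt * ‖w x - w y‖ ≤ Δt * (L * ‖x - y‖) := by gcongr
  linarith

/-- Points outside `Ω` are fixed. If `X x` were outside, then X(X x) = X x, and injectivity would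
give X x = x. -/
theorem X1_mapsTo {Ω : Set (Pt d)} {w : Pt d → Pt d} {Δt : ℝ} (hX : Function.Injective (X1 Δt w))
    (hw : ∀ x ∉ Ω, w x = 0) : ∀ x ∈ Ω, X1 Δt w x ∈ Ω := by
  intro x hx
  by_contra hn
  have : X1 Δt w (X1 Δt w x) = X1 Δt w x := by
    conv_lhs => rw [X1, hw _ hn, smul_zero, sub_zero]
  exact hn ((hX this).symm ▸ hx)

theorem eLpNorm_comp_le {Ω : Set (Pt d)} {K : NNReal} {X : Pt d → Pt d} (hX : AntilipschitzWith K X)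
    (hXc : Continuous X) (hmaps : ∀ x ∈ Ω, X x ∈ Ω) {v : Pt d → ℝ}
    (hv : AEStronglyMeasurable v (volume.restrict Ω)) {q : NNReal} (hq : K ^ d ≤ q ^ 2) :
    eLpNorm (fun x => v (X x)) 2 (volume.restrict Ω) ≤ q * eLpNorm v 2 (volume.restrict Ω) := by
  have h2 : ∀ u : Pt d → ℝ, eLpNorm u 2 (volume.restrict Ω) ^ (2 : ℝ)
      = ∫⁻ x in Ω, ‖u x‖ₑ ^ (2 : ℝ) := fun u => by
    have := eLpNorm_nnreal_pow_eq_lintegral (f := u) (μ := volume.restrict Ω) (p := 2) two_ne_zero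
    simpa using this
  rw [← ENNReal.rpow_le_rpow_iff (z := 2) two_pos, ENNReal.mul_rpow_of_nonneg _ _ zero_le_two, h2, h2]
  refine (lintegral_comp_le hX hXc hmaps (g := fun x => ‖v x‖ₑ ^ (2 : ℝ))
    (hv.enorm.pow_const _)).trans ?_
  gcongr
  rw [ENNReal.rpow_two]
  exact_mod_cast hq

/-- Turns the volume factor into an exponential linear in `s`, which compounds over the time steps
to a bound depending on T alone. The square on the right, and hence the 2 in the exponent, reflects
that volume controls squared `L²` norms. -/
theorem inv_one_sub_pow_le {s δ : ℝ} (hs : 0 ≤ s) (hsδ : s ≤ δ) (hδ : δ < 1) (d : ℕ) :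
    ((1 - s)⁻¹) ^ d ≤ Real.exp (d / (2 * (1 - δ)) * s) ^ 2 := by
  have h1 : 0 < 1 - s := by linarith
  have h2 : 0 < 1 - δ := by linarith
  have h3 : (1 - s)⁻¹ ≤ Real.exp (s / (1 - δ)) := by
    calc (1 - s)⁻¹ = s / (1 - s) + 1 := by field_simp; ring
      _ ≤ s / (1 - δ) + 1 := by gcongr
      _ ≤ _ := Real.add_one_le_exp _
  calc ((1 - s)⁻¹) ^ d ≤ Real.exp (s / (1 - δ)) ^ d := by gcongr
    _ = Real.exp (d / (2 * (1 - δ)) * s) ^ 2 := by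
      rw [← Real.exp_nat_mul, ← Real.exp_nat_mul]
      congr 1
      push_cast
      field_simp

/-! ### The discrete energy estimate -/

theorem l2norm_toLp {F : Type*} [NormedAddCommGroup F] {Ω : Set (Pt d)}
    {v : Pt d → F} (hv : MemLp v 2 (volume.restrict Ω)) : ‖hv.toLp v‖ = l2norm Ω v :=
  Lp.norm_toLp v hv

theorem integral_inner_le {F : Type*} [NormedAddCommGroup F] [InnerProductSpace ℝ F]
    {Ω : Set (Pt d)} {v w : Pt d → F} (hv : MemLp v 2 (volume.restrict Ω))
    (hw : MemLp w 2 (volume.restrict Ω)) :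
    ∫ x in Ω, inner ℝ (v x) (w x) ≤ l2norm Ω v * l2norm Ω w := by
  have h := real_inner_le_norm (hv.toLp v) (hw.toLp w)
  rw [l2norm_toLp, l2norm_toLp, L2.inner_def] at h
  refine le_of_eq_of_le (integral_congr_ae ?_) h
  filter_upwards [hv.coeFn_toLp, hw.coeFn_toLp] with x h1 h2
  rw [h1, h2]

theorem integral_inner_self_eq {F : Type*} [NormedAddCommGroup F] [InnerProductSpace ℝ F]
    {Ω : Set (Pt d)} {v : Pt d → F} (hv : MemLp v 2 (volume.restrict Ω)) :
    ∫ x in Ω, inner ℝ (v x) (v x) = l2norm Ω v ^ 2 := by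
  have h := real_inner_self_eq_norm_sq (hv.toLp v)
  rw [l2norm_toLp, L2.inner_def] at h
  rw [← h]
  refine integral_congr_ae ?_
  filter_upwards [hv.coeFn_toLp] with x h1
  rw [h1]

theorem integral_mul_le_l2norm {Ω : Set (Pt d)} {v w : Pt d → ℝ}
    (hv : MemLp v 2 (volume.restrict Ω)) (hw : MemLp w 2 (volume.restrict Ω)) :
    ∫ x in Ω, v x * w x ≤ l2norm Ω v * l2norm Ω w := by
  have := integral_inner_le hv hw
  simpa [mul_comm] using this

theorem integral_mul_self_eq_l2norm {Ω : Set (Pt d)} {v : Pt d → ℝ}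
    (hv : MemLp v 2 (volume.restrict Ω)) : ∫ x in Ω, v x * v x = l2norm Ω v ^ 2 := by
  have := integral_inner_self_eq hv
  simpa [pow_two] using this

/-- Stability of a discrete evolution, from its one-step energy inequality. -/
theorem discrete_stability {T Δt ν q E : ℝ} (hΔt : 0 < Δt) (hν : 0 < ν) (hq : 1 ≤ q) {N : ℕ}
    (hN : N * Δt ≤ T) (hE : q ^ N ≤ E) {a b F : ℕ → ℝ} (ha : ∀ n, 0 ≤ a n) (hF : ∀ n, 0 ≤ F n)
    (hstep : ∀ n < N, a (n + 1) ^ 2 + ν * Δt * b (n + 1) ^ 2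
      ≤ q * a n * a (n + 1) + Δt * F (n + 1) * a (n + 1)) :
    ellInf N a + Real.sqrt ν * ellTwo Δt N b
      ≤ (3 + E) * E * (1 + Real.sqrt T) * (a 0 + ellTwo Δt N F) := by
  have hq0 : 0 < q := by linarith
  have hE1 : 1 ≤ E := (one_le_pow₀ hq).trans hE
  set R := ellTwo Δt N F with hR
  have hR0 : 0 ≤ R := Real.sqrt_nonneg _
  have hIcc : ∀ G : ℕ → ℝ, ∑ n ∈ Finset.Icc 1 N, G n = ∑ n ∈ Finset.range N, G (n + 1) := fun G => by
    rw [Finset.range_eq_Ico, Finset.sum_Ico_add' G 0 N 1]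
    rfl
  -- Cauchy–Schwarz in time, with NΔt ≤ T.
  have hsumF : Δt * ∑ n ∈ Finset.range N, F (n + 1) ≤ Real.sqrt T * R := by
    have h1 : (∑ n ∈ Finset.range N, F (n + 1)) ^ 2
        ≤ N * ∑ n ∈ Finset.range N, F (n + 1) ^ 2 := by
      simpa using sq_sum_le_card_mul_sum_sq (s := Finset.range N) (f := fun n => F (n + 1))
    rw [hR, ellTwo, hIcc (fun n => F n ^ 2), ← Real.sqrt_mul ((by positivity : 0 ≤ N * Δt).trans hN)]
    refine Real.le_sqrt_of_sq_le ?_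
    calc (Δt * ∑ n ∈ Finset.range N, F (n + 1)) ^ 2
        = Δt ^ 2 * (∑ n ∈ Finset.range N, F (n + 1)) ^ 2 := by ring
      _ ≤ Δt ^ 2 * (N * ∑ n ∈ Finset.range N, F (n + 1) ^ 2) := by gcongr
      _ = (N * Δt) * (Δt * ∑ n ∈ Finset.range N, F (n + 1) ^ 2) := by ring
      _ ≤ T * (Δt * ∑ n ∈ Finset.range N, F (n + 1) ^ 2) := by gcongr
  -- The dissipation is dropped and one factor `a (n + 1)` cancelled; the case where it vanishes is
  -- trivial.
  have hrec : ∀ n < N, a (n + 1) ≤ q * a n + Δt * F (n + 1) := by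
    intro n hn
    rcases (ha (n + 1)).eq_or_lt with h0 | h0
    · rw [← h0]
      have := ha n
      have := hF (n + 1)
      positivity
    · refine le_of_mul_le_mul_right ?_ h0
      have := hstep n hn
      have hb : 0 ≤ ν * Δt * b (n + 1) ^ 2 := by positivity
      linarith
  have hgron : ∀ n ≤ N, a n ≤ q ^ n * (a 0 + Δt * ∑ m ∈ Finset.range n, F (m + 1)) := by
    intro n
    induction n with
    | zero => simp
    | succ n ih =>
      intro hn
      have h1 := ih (by omega)
      have h2 := hrec n (by omega)
      have h3 : (1 : ℝ) ≤ q ^ (n + 1) := one_le_pow₀ hq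
      have h4 : Δt * F (n + 1) ≤ q ^ (n + 1) * (Δt * F (n + 1)) :=
        le_mul_of_one_le_left (mul_nonneg hΔt.le (hF _)) h3
      calc a (n + 1) ≤ q * a n + Δt * F (n + 1) := h2
        _ ≤ q * (q ^ n * (a 0 + Δt * ∑ m ∈ Finset.range n, F (m + 1)))
            + q ^ (n + 1) * (Δt * F (n + 1)) := by gcongr
        _ = _ := by rw [Finset.sum_range_succ]; ring
  set M := E * (a 0 + Real.sqrt T * R) with hM
  have hM0 : 0 ≤ M := by have := ha 0; positivity
  have hmax : ∀ n ≤ N, a n ≤ M := by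
    intro n hn
    refine (hgron n hn).trans ?_
    have h1 : Δt * ∑ m ∈ Finset.range n, F (m + 1) ≤ Real.sqrt T * R := by
      refine le_trans ?_ hsumF
      gcongr
      exact fun _ _ _ => hF _
    have h2 : 0 ≤ a 0 + Δt * ∑ m ∈ Finset.range n, F (m + 1) :=
      add_nonneg (ha 0) (mul_nonneg hΔt.le (Finset.sum_nonneg fun _ _ => hF _))
    have h3 : q ^ n ≤ E := (pow_le_pow_right₀ hq hn).trans hE
    exact mul_le_mul h3 (by linarith) h2 (by linarith)
  have hTR : Real.sqrt T * R ≤ M := by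
    have h1 : 0 ≤ a 0 + Real.sqrt T * R := by have := ha 0; positivity
    have := le_mul_of_one_le_left h1 hE1
    have := ha 0
    linarith
  have hdiss : ν * (Δt * ∑ n ∈ Finset.range N, b (n + 1) ^ 2) ≤ ((2 + E) * M) ^ 2 := by
    -- Young's inequality for q·a n·a (n + 1) leaves a telescoping difference and a remainder with
    -- factor (q² - 1)/2.
    have hn : ∀ n ∈ Finset.range N, ν * Δt * b (n + 1) ^ 2
        ≤ (a n ^ 2 - a (n + 1) ^ 2) / 2 + (q ^ 2 - 1) / 2 * M ^ 2 + M * (Δt * F (n + 1)) := by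
      intro n hn
      have hn := Finset.mem_range.1 hn
      have h1 := hstep n hn
      have h2 : (q ^ 2 - 1) / 2 * a n ^ 2 ≤ (q ^ 2 - 1) / 2 * M ^ 2 := by
        have : 1 ≤ q ^ 2 := one_le_pow₀ hq
        have := ha n
        have := hmax n hn.le
        have : 0 ≤ (q ^ 2 - 1) / 2 := by linarith
        gcongr
      have h3 : Δt * F (n + 1) * a (n + 1) ≤ Δt * F (n + 1) * M :=
        mul_le_mul_of_nonneg_left (hmax _ hn) (mul_nonneg hΔt.le (hF _))
      linarith [sq_nonneg (q * a n - a (n + 1))]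
    have hsum := Finset.sum_le_sum hn
    rw [Finset.sum_add_distrib, Finset.sum_add_distrib, ← Finset.sum_div,
      Finset.sum_range_sub', Finset.sum_const, Finset.card_range, nsmul_eq_mul, ← Finset.mul_sum,
      ← Finset.mul_sum, ← Finset.mul_sum] at hsum
    -- Bernoulli's inequality bounds the accumulated remainder factor uniformly in the number of
    -- steps.
    have hbern : N * (q ^ 2 - 1) ≤ E ^ 2 := by
      have h1 := one_add_mul_le_pow (a := q ^ 2 - 1) (by nlinarith) N
      have h2 : (1 + (q ^ 2 - 1)) ^ N = (q ^ N) ^ 2 := by rw [add_sub_cancel, ← pow_mul, ← pow_mul, mul_comm]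
      have h3 : (q ^ N) ^ 2 ≤ E ^ 2 := by gcongr
      linarith
    have h1 : a 0 ^ 2 ≤ M ^ 2 := by
      have := ha 0
      have := hmax 0 (Nat.zero_le _)
      gcongr
    have h2 : M * (Δt * ∑ n ∈ Finset.range N, F (n + 1)) ≤ M * M := by
      gcongr
      exact hsumF.trans hTR
    have h3 : N * ((q ^ 2 - 1) / 2 * M ^ 2) ≤ E ^ 2 / 2 * M ^ 2 := by
      calc N * ((q ^ 2 - 1) / 2 * M ^ 2) = N * (q ^ 2 - 1) / 2 * M ^ 2 := by ring
        _ ≤ _ := by gcongr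
    have h4 : 0 ≤ E * M ^ 2 := by positivity
    have h5 : 0 ≤ E ^ 2 * M ^ 2 := by positivity
    nlinarith [sq_nonneg (a N), sq_nonneg M]
  have hdiss' : Real.sqrt ν * ellTwo Δt N b ≤ (2 + E) * M := by
    rw [ellTwo, ← Real.sqrt_mul hν.le, hIcc fun n => b n ^ 2]
    exact Real.sqrt_le_iff.2 ⟨by positivity, hdiss⟩
  have hinf : ellInf N a ≤ M :=
    Finset.sup'_le _ _ fun n hn => hmax n (Nat.lt_succ_iff.1 (Finset.mem_range.1 hn))
  have hfin : a 0 + Real.sqrt T * R ≤ (1 + Real.sqrt T) * (a 0 + R) := by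
    have := ha 0
    have : 0 ≤ Real.sqrt T * a 0 := by positivity
    linarith
  calc ellInf N a + Real.sqrt ν * ellTwo Δt N b ≤ M + (2 + E) * M := add_le_add hinf hdiss'
    _ = (3 + E) * E * (a 0 + Real.sqrt T * R) := by rw [hM]; ring
    _ ≤ (3 + E) * E * ((1 + Real.sqrt T) * (a 0 + R)) := by gcongr
    _ = _ := by ring

/-! ### The scheme -/

/-- The one-step energy inequality of the scheme. -/
theorem IsGSLGSolution.energy_step {Ω : Set (Pt d)} (hΩo : IsOpen Ω)
    (hΩ : interior (closure Ω) = Ω) {T : ℝ} {k : ℕ} {u : ℝ → Pt d → Pt d}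
    {𝒯 : Geometry.SimplicialComplex ℝ (Pt d)} (h𝒯 : IsTriangulation 𝒯 Ω) {Δt ν : ℝ} (hΔt : 0 < Δt)
    {f : ℝ → Lp ℝ 2 (volume.restrict Ω)} {φ0 : Pt d → ℝ} {φ : ℕ → Pt d → ℝ}
    (h : IsGSLGSolution Ω T k u 𝒯 Δt ν f φ0 φ) {L δ : ℝ} (hL : 0 ≤ L) (hLδ : Δt * L ≤ δ)
    (hδ : δ < 1) {n : ℕ} (hn : n < numSteps T Δt)
    (hu : ∀ x ∈ frontier Ω, u ((n + 1 : ℕ) * Δt) x = 0)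
    (hs : semiW1inf Ω (lagrangeP1 𝒯 (u ((n + 1 : ℕ) * Δt))) ≤ ENNReal.ofReal L) :
    l2norm Ω (φ (n + 1)) ^ 2 + ν * Δt * l2norm Ω (weakGrad Ω (φ (n + 1))) ^ 2
      ≤ Real.exp (d / (2 * (1 - δ)) * (Δt * L)) * l2norm Ω (φ n) * l2norm Ω (φ (n + 1))
        + Δt * ‖f ((n + 1 : ℕ) * Δt)‖ * l2norm Ω (φ (n + 1)) := by
  have hVh : ∀ m ≤ numSteps T Δt, MemVh Ω 𝒯 k (φ m) := fun m hm => by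
    rcases Nat.eq_zero_or_pos m with rfl | hm0
    exacts [h.init.1, h.mem m hm0 hm]
  set w := lagrangeP1 𝒯 (u ((n + 1 : ℕ) * Δt)) with hw
  have hlip : LipschitzWith L.toNNReal w := lipschitzWith_lagrangeP1 h𝒯 hΩo hΩ hu hL hs
  have hanti := antilipschitzWith_X1 hL hΔt hlip (by linarith)
  have hXc : Continuous (X1 Δt w) := continuous_id.sub (hlip.continuous.const_smul Δt)
  have hmaps := X1_mapsTo (Ω := Ω) hanti.injective fun x hx => lagrangeP1_eq_zero h𝒯 hΩo hΩ hu hx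
  set q := Real.exp (d / (2 * (1 - δ)) * (Δt * L)) with hq
  have hVn := hVh n hn.le
  have hVn1 := hVh (n + 1) hn
  have m0 : MemLp (φ n) 2 (volume.restrict Ω) := hVn.2.1.1.1
  have m1 : MemLp (φ (n + 1)) 2 (volume.restrict Ω) := hVn1.2.1.1.1
  have hcomp : eLpNorm (fun x => φ n (X1 Δt w x)) 2 (volume.restrict Ω)
      ≤ q.toNNReal * eLpNorm (φ n) 2 (volume.restrict Ω) := by
    refine eLpNorm_comp_le hanti hXc hmaps m0.1 ?_
    rw [← Real.toNNReal_pow (Real.exp_pos _).le,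
      ← Real.toNNReal_pow (inv_nonneg.2 (by linarith))]
    exact Real.toNNReal_le_toNNReal (inv_one_sub_pow_le (by positivity) hLδ hδ d)
  have mX : MemLp (fun x => φ n (X1 Δt w x)) 2 (volume.restrict Ω) := by
    -- Measurability of the composition follows from continuity of `φ n` on the closure of `Ω`, into
    -- which `X` maps.
    refine ⟨?_, hcomp.trans_lt (ENNReal.mul_lt_top ENNReal.coe_lt_top m0.2)⟩
    refine ContinuousOn.aestronglyMeasurable ?_ hΩo.measurableSet
    exact hVn.1.comp hXc.continuousOn fun x hx => subset_closure (hmaps x hx)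
  have hcomp' : l2norm Ω (fun x => φ n (X1 Δt w x)) ≤ q * l2norm Ω (φ n) := by
    have := ENNReal.toReal_mono (ENNReal.mul_ne_top ENNReal.coe_ne_top m0.2.ne) hcomp
    rwa [ENNReal.toReal_mul, ENNReal.coe_toReal, Real.coe_toNNReal _ (Real.exp_pos _).le] at this
  have hstep := h.step (n + 1) (by omega) hn (φ (n + 1)) hVn1
  rw [Nat.add_sub_cancel, ← hw, integral_inner_self_eq hVn1.2.1.1.2.2] at hstep
  have hsplit : ∫ x in Ω, (φ (n + 1) x - φ n (X1 Δt w x)) / Δt * φ (n + 1) x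
      = (l2norm Ω (φ (n + 1)) ^ 2 - ∫ x in Ω, φ n (X1 Δt w x) * φ (n + 1) x) / Δt := by
    have i1 : Integrable (fun x => φ (n + 1) x * φ (n + 1) x) (volume.restrict Ω) :=
      m1.integrable_mul m1
    have i2 : Integrable (fun x => φ n (X1 Δt w x) * φ (n + 1) x) (volume.restrict Ω) :=
      mX.integrable_mul m1
    rw [← integral_mul_self_eq_l2norm m1, ← integral_sub i1 i2, ← integral_div]
    congr 1; ext x; ring
  rw [hsplit] at hstep
  have c1 := integral_mul_le_l2norm mX m1
  have c2 : ∫ x in Ω, f ((n + 1 : ℕ) * Δt) x * φ (n + 1) x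
      ≤ ‖f ((n + 1 : ℕ) * Δt)‖ * l2norm Ω (φ (n + 1)) :=
    integral_mul_le_l2norm (Lp.memLp _) m1
  have hnn : 0 ≤ l2norm Ω (φ (n + 1)) := ENNReal.toReal_nonneg
  have c3 := c1.trans (mul_le_mul_of_nonneg_right hcomp' hnn)
  have c4 := mul_le_mul_of_nonneg_left (hstep.trans_le c2) hΔt.le
  rw [mul_add, mul_div_cancel₀ _ hΔt.ne'] at c4
  linarith

end GSLG

end

/-! ### Choice of the constant and the final estimate. -/

theorem theorem1 (d : ℕ) (hd : d = 2 ∨ d = 3) (Ω : Set (GSLG.Pt d)) (hΩ : GSLG.IsPolyDomain Ω)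
    (T : ℝ) (hT : 0 < T) (k : ℕ) (hk : 1 ≤ k)
    (𝔗 : Set (Geometry.SimplicialComplex ℝ (GSLG.Pt d))) (h𝔗 : GSLG.IsRegularFamily 𝔗 Ω)
    (u : ℝ → GSLG.Pt d → GSLG.Pt d) (hu : GSLG.MemCW01inf Ω T u) :
    (∃ α, GSLG.IsInterpConst Ω 𝔗 α) ∧ (∃ δ, GSLG.IsJacobianConst Ω δ) ∧
    ∀ α δ : ℝ, GSLG.IsInterpConst Ω 𝔗 α → GSLG.IsJacobianConst Ω δ →
      ∃ c : ℝ, 0 < c ∧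
        ∀ 𝒯 ∈ 𝔗, ∀ Δt : ℝ, 0 < Δt →
          ENNReal.ofReal Δt ≤
            ENNReal.ofReal δ / (ENNReal.ofReal α * GSLG.semiCW1inf Ω T u) →
        ∀ ν : ℝ, 0 < ν →
        ∀ f : ℝ → Lp ℝ 2 (volume.restrict Ω), ContinuousOn f (Icc 0 T) →
        ∀ φ0 : GSLG.Pt d → ℝ, GSLG.MemH10 Ω φ0 →
        ∀ φ : ℕ → GSLG.Pt d → ℝ, GSLG.IsGSLGSolution Ω T k u 𝒯 Δt ν f φ0 φ →
          GSLG.ellInf (GSLG.numSteps T Δt) (fun n => GSLG.l2norm Ω (φ n))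
            + Real.sqrt ν * GSLG.ellTwo Δt (GSLG.numSteps T Δt)
                (fun n => GSLG.l2norm Ω (GSLG.weakGrad Ω (φ n)))
          ≤ c * (GSLG.l2norm Ω (φ 0)
            + GSLG.ellTwo Δt (GSLG.numSteps T Δt) (fun n => ‖f (n * Δt)‖)) := by
  obtain ⟨hΩo, -, hΩ, -⟩ := hΩ
  have hd0 : 0 < d := by omega
  refine ⟨GSLG.exists_interpConst hd0 hΩo hΩ h𝔗, GSLG.exists_jacobianConst Ω, ?_⟩
  intro α δ hα hδ
  have hα0 : 0 < α := one_pos.trans_le hα.1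
  set A := ENNReal.ofReal α * GSLG.semiCW1inf Ω T u with hA
  set L := A.toReal with hLdef
  have hL : 0 ≤ L := ENNReal.toReal_nonneg
  set B := d / (2 * (1 - δ)) * L with hB
  have hB0 : 0 ≤ B := by
    have : 0 < 1 - δ := by linarith [hδ.2.1]
    positivity
  -- The constant of `discrete_stability` with E = e^{BT}, which bounds the N-th power of q =
  -- e^{BΔt}; it depends only on d, δ, T and L.
  refine ⟨(3 + Real.exp (B * T)) * Real.exp (B * T) * (1 + Real.sqrt T), by positivity, ?_⟩
  intro 𝒯 h𝒯 Δt hΔt hle ν hν f _ φ0 _ φ hφ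
  -- Finiteness follows from the time-step restriction: for `A = ⊤` the quotient would be 0, against
  -- Δt > 0. For `A = 0` the quotient is ∞ and Δt is unrestricted.
  have hAtop : A ≠ ⊤ := by
    intro h
    rw [h, ENNReal.div_top, nonpos_iff_eq_zero, ENNReal.ofReal_eq_zero] at hle
    linarith
  have hAL : A = ENNReal.ofReal L := (ENNReal.ofReal_toReal hAtop).symm
  have hLδ : Δt * L ≤ δ := by
    have h1 := ENNReal.mul_le_of_le_div hle
    rwa [hAL, ← ENNReal.ofReal_mul hΔt.le, ENNReal.ofReal_le_ofReal_iff hδ.1.le] at h1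
  have hNT : (GSLG.numSteps T Δt : ℝ) * Δt ≤ T := by
    rw [← le_div_iff₀ hΔt]
    exact Nat.floor_le (by positivity)
  refine GSLG.discrete_stability (q := Real.exp (B * Δt)) hΔt hν
    (Real.one_le_exp (by positivity)) hNT ?_ (fun _ => ENNReal.toReal_nonneg)
    (fun _ => norm_nonneg _) fun n hn => ?_
  · rw [← Real.exp_nat_mul]
    refine Real.exp_le_exp.2 ?_
    calc (GSLG.numSteps T Δt : ℝ) * (B * Δt) = B * (GSLG.numSteps T Δt * Δt) := by ring
      _ ≤ B * T := by gcongr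
  · have ht : ((n + 1 : ℕ) : ℝ) * Δt ∈ Icc 0 T := by
      refine ⟨by positivity, le_trans ?_ hNT⟩
      gcongr
      exact hn
    have hut := hu.1 _ ht
    have hs : GSLG.semiW1inf Ω (GSLG.lagrangeP1 𝒯 (u ((n + 1 : ℕ) * Δt))) ≤ ENNReal.ofReal L := by
      rw [← hAL, hA]
      refine (hα.2 𝒯 h𝒯 _ hut.1).trans ?_
      gcongr
      exact le_iSup₂ (f := fun t (_ : t ∈ Icc 0 T) => GSLG.semiW1inf Ω (u t)) _ ht
    have := hφ.energy_step hΩo hΩ (h𝔗.1 𝒯 h𝒯) hΔt hL hLδ hδ.2.1 hn hut.2 hs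
    have e : d / (2 * (1 - δ)) * (Δt * L) = B * Δt := by rw [hB]; ring
    rwa [e] at this
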